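/- Let $(\Omega,\mathcal F)$ be a measurable space with $\{\emptyset,\Omega\}\subsetneq\mathcal F$, let $\mathcal M^1$ be the set of probability measures on it and let $\mathcal B$ be the set of measurable functions $\Omega\to[-1,1]$. Write $\nu(g)=\int g\,d\nu$, and let $\mathrm{TV}(\mu,\nu)=\sup_{g\in\mathcal B}|\mu(g)-\nu(g)|\in[0,2]$. Let $\phi:\mathbb R\to\mathbb R\cup\{+\infty\}$ be convex and lower semicontinuous, finite in a neighbourhood of $1$, equal to $+\infty$ on $(-\infty,0)$, and non-negative with $\phi(1)=0$. Put $\phi'(\infty)=\lim_{x\to\infty}\phi(x)/x$, $\psi(x)=\phi(x+1)$ and $\psi^\star(y)=\sup_{x\in\mathbb R}\{xy-\psi(x)\}$. For $\mu,\nu\in\mathcal M^1$, with Lebesgue decomposition $\mu=\mu_c+\mu_s$, $\mu_c\ll\nu$, $\mu_s\perp\nu$, let $$D_\phi(\mu\|\nu)=\int\phi\Big(\frac{d\mu_c}{d\nu}\Big)d\nu+\mu_s(\Omega)\,\phi'(\infty)\qquad(0\cdot\infty=0).$$ For $g\in\mathcal B$, or more generally $g$ bounded measurable, and $t\in\mathbb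 R$ let $$K_{g,\nu}(t)=\inf\Big\{\int\psi^\star(tg+\lambda)\,d\nu\;:\;\lambda\in\mathbb R,\ \lambda+\operatorname{ess\,sup}_\nu(tg)\le\phi'(\infty)\Big\}.$$ For $\varepsilon\ge0$ let $L_\phi(\varepsilon)=\inf\{D_\phi(\mu\|\nu):\mu,\nu\in\mathcal M^1,\ \mathrm{TV}(\mu,\nu)=\varepsilon\}$ (with $\inf\emptyset=+\infty$). For $w\ge0$ let $$h(w)=\inf\{s\in[0,+\infty]:\operatorname{Leb}\{x\in\mathbb R:\psi^\star(x)\le s\}\ge w\}$$ be the height-for-width function of $\psi^\star$, and let $h^\star(y)=\sup_{w\ge0}\{wy-h(w)\}$. Then: 1. For every $w\ge0$, $h(w)$ is finite and $h(w)=\inf_{\lambda\in\mathbb R}\max\{\psi^\star(\lambda+w/2),\psi^\star(\lambda-w/2)\}$. 2. For every $t\ge0$, $\sup\{K_{g,\nu}(t):g\in\mathcal B,\ \nu\in\mathcal M^1\}=h(2t)$. 3. For every $\varepsilon\ge0$, $L_\phi(\varepsilon)=h^\star(\varepsilon/2)$. In particular, if $h$ is differentiable at $x\ge0$ (from the right if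 $x=0$), then $L_\phi(2h'(x))=x\,h'(x)-h(x)$. For the Kullback--Leibler divergence take $\phi(x)=x\log x-x+1$ for $x\ge0$ (with $0\log0=0$) and $\phi(x)=+\infty$ for $x<0$. This $\phi$ satisfies the assumptions above, $D_\phi(\mu\|\nu)=\mathrm{KL}(\mu\|\nu)$ for all $\mu,\nu\in\mathcal M^1$, and: 4. $h(w)=-1+\frac w2\coth\frac w2+\log\frac{2\sinh(w/2)}{w}$ for all $w>0$. 5. (Refined Hoeffding lemma.) $K_{g,\nu}(t)=\log\int e^{t(g-\nu(g))}d\nu$ for all $\nu\in\mathcal M^1$, all bounded measurable $g$ and all $t\in\mathbb R$. If $g$ is measurable with $m\le g\le M$ $\nu$-almost surely and $\nu(g)=0$, then $\log\int e^{tg}d\nu\le h((M-m)t)$ for all $t\ge0$. 6. (Fedotov--Harremoës--Topsøe formula.) For every $t>0$, with $V(t)=2\coth t-\frac{t}{\sinh^2t}-\frac1t$, $$\inf\{\mathrm{KL}(\mu\|\nu):\mu,\nu\in\mathcal M^1,\ \mathrm{TV}(\mu,\nu)=V(t)\}=\log\frac{t}{\sinh t}+t\coth t-\frac{t^2}{\sinh^2t}.$$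 -/

import Mathlib

open MeasureTheory Set Filter Topology
open scoped ENNReal

noncomputable section

/-- The standing assumptions on the generator `φ : ℝ → ℝ ∪ {+∞}` of a `φ`-divergence, in the
normal form for probability measures: `φ` is convex (its epigraph is convex), lower
semicontinuous, finite near `1`, infinite on the negative reals, and non-negative with
`φ 1 = 0`, i.e. `0 ∈ ∂φ(1)`. -/
structure IsDivergenceGenerator (φ : ℝ → EReal) : Prop where
  convex : Convex ℝ {p : ℝ × ℝ | φ p.1 ≤ (p.2 : EReal)}
  lsc : LowerSemicontinuous φ
  map_one : φ 1 = 0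
  nonneg : ∀ x, 0 ≤ φ x
  eq_top_of_neg : ∀ x, x < 0 → φ x = ⊤
  dom_mem_nhds : {x | φ x < ⊤} ∈ 𝓝 (1 : ℝ)

/-- `φ'(∞) = lim_{x → ∞} φ(x) / x`. The limit exists in `ℝ ∪ {+∞}` for proper convex `φ`, so it
can be written as a `limsup`. -/
def recession (φ : ℝ → EReal) : EReal :=
  limsup (fun x : ℝ => φ x / (x : EReal)) atTop

/-- Convex conjugate of a function defined on a set `s ⊆ ℝ` (and `+∞` elsewhere):
`f*(y) = sup_{x ∈ s} (x y - f x)`. -/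
def conjOn (s : Set ℝ) (f : ℝ → EReal) (y : ℝ) : EReal :=
  ⨆ x ∈ s, ((x * y : ℝ) : EReal) - f x

/-- The conjugate `ψ*` of `ψ(x) = φ(x + 1)`. -/
def psiConj (φ : ℝ → EReal) : ℝ → EReal :=
  conjOn univ (fun x => φ (x + 1))

/-- Lebesgue measure of the sublevel set `{x | f x ≤ h}`. -/
def sublevelVolume (f : ℝ → EReal) (h : EReal) : ℝ≥0∞ :=
  volume {x : ℝ | f x ≤ h}

/-- The height-for-width function `w ↦ inf {h ≥ 0 | sublevelVolume f h ≥ w}`, meant for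
`w ≥ 0`. -/
def heightForWidth (f : ℝ → EReal) (w : ℝ) : EReal :=
  sInf {h : EReal | 0 ≤ h ∧ ENNReal.ofReal w ≤ sublevelVolume f h}

variable {Ω : Type*} [MeasurableSpace Ω]

/-- The `φ`-divergence `D(μ‖ν) = ∫ φ(dμ_c/dν) dν + μ_s(Ω) φ'(∞)` of non-negative measures, where
`μ = μ_c + μ_s` is the Lebesgue decomposition of `μ` with respect to `ν`, for non-negative `φ`
and with `0 * ∞ = 0`. -/
def phiDiv (φ : ℝ → EReal) (μ ν : Measure Ω) : ℝ≥0∞ :=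
  ∫⁻ x, (φ ((μ.rnDeriv ν x).toReal)).toENNReal ∂ν
    + μ.singularPart ν univ * (recession φ).toENNReal

/-- The set of measurable functions `Ω → [-1, 1]`. -/
def unitFunctions (Ω : Type*) [MeasurableSpace Ω] : Set (Ω → ℝ) :=
  {g | Measurable g ∧ ∀ x, g x ∈ Icc (-1 : ℝ) 1}

/-- The total variation distance, normalized to take values in `[0, 2]` on probability
measures: the supremum of `|μ(g) - ν(g)|` over the measurable `g : Ω → [-1, 1]`. -/
def tvDist (μ ν : Measure Ω) : ℝ≥0∞ :=
  ⨆ g ∈ unitFunctions Ω, ENNReal.ofReal |∫ x, g x ∂μ - ∫ x, g x ∂ν|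

/-- Vajda's function of a divergence `D`: the infimum of `D(μ‖ν)` over all pairs of probability
measures on `Ω` at total variation distance exactly `ε` (`+∞` if there are none). -/
def vajda (D : Measure Ω → Measure Ω → ℝ≥0∞) (ε : ℝ) : ℝ≥0∞ :=
  sInf {d | ∃ μ ν : Measure Ω, IsProbabilityMeasure μ ∧ IsProbabilityMeasure ν ∧
    tvDist μ ν = ENNReal.ofReal ε ∧ d = D μ ν}

/-- The `φ`-cumulant generating function
`K_{g,ν}(t) = inf {∫ ψ*(t g + l) dν | l + ess sup_ν (t g) ≤ φ'(∞)}`, for non-negative `ψ*`. -/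
def phiCgf (φ : ℝ → EReal) (g : Ω → ℝ) (ν : Measure Ω) (t : ℝ) : ℝ≥0∞ :=
  ⨅ l ∈ {l : ℝ | (l : EReal) + essSup (fun x => ((t * g x : ℝ) : EReal)) ν ≤ recession φ},
    ∫⁻ x, (psiConj φ (t * g x + l)).toENNReal ∂ν

/-- The supremum of `K_{g,ν}(t)` over all measurable `g : Ω → [-1, 1]` and all probability
measures `ν` on `Ω`. -/
def supPhiCgf (Ω : Type*) [MeasurableSpace Ω] (φ : ℝ → EReal) (t : ℝ) : ℝ≥0∞ :=
  ⨆ ν : ProbabilityMeasure Ω, ⨆ g ∈ unitFunctions Ω, phiCgf φ g (ν : Measure Ω) t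

/-- The normalized generator of the Kullback--Leibler divergence: `x log x + 1 - x` for `x ≥ 0`,
and `+∞` for `x < 0`. -/
def klGenerator (x : ℝ) : EReal :=
  if 0 ≤ x then ((InformationTheory.klFun x : ℝ) : EReal) else ⊤

end

/-! The theorem is convex duality between `φ` and `ψ*`, reduced to two points. By convexity and
coercivity a non-empty sublevel set of `ψ*` is a compact interval, so `h(w) < c` provides a centre
`l` with `[l - w/2, l + w/2]` inside `{ψ* ≤ c}`. This gives the formula for `h` as a minimum over
`l`. It also shows that `h` is convex, being a partial minimum of a jointly convex function of `(l,
w)`.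

Weak duality: if `[l - t, l + t]` lies in `{ψ* ≤ c}` and `|g| ≤ 1`, then `t g + l` takes values in
that interval. Hence `K_{g,ν}(t) ≤ c`. Integrating Young's inequality gives `t (μ(g) - ν(g)) - c ≤
D(μ‖ν)` (`ofReal_mul_integral_sub_le_phiDiv`), where the singular part of `μ` is controlled because
`ψ*` is infinite beyond `φ'(∞)` (`le_recession`). Optimizing over `g`, `l` and `w` yields `L(ε) ≥
h*(ε/2)`.

Strong duality: `exists_convexCombination_le` replaces the maximum of the values of `ψ*` at two
points by an average with weights `p` and `1 - p`, and these become the masses of a two-point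
measure `ν`. For `K` this is already the extremal `ν`. For `L`, Fenchel--Moreau turns the suprema
over the two dual variables into `p φ(1 + δ/p) + (1 - p) φ(1 - δ/(1 - p))`, or into `δ φ'(∞) + φ(1 -
δ)` when `p = 0`. Both are divergences of pairs of two-point measures at distance `2δ`.

For Kullback--Leibler, `ψ*(y) = exp y - 1 - y`. The optimal `l` equalizes the two endpoint values,
and the Fedotov--Harremoës--Topsøe formula is `x h'(x) - h(x)` at `x = 2t`. -/

/-! ### A planar minimax theorem -/

/-- Minimax in the plane: a convex set that misses the open quadrant above `(m, m)` lies in a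
half-plane `p a + (1 - p) b ≤ m`. -/
theorem exists_convexCombination_le {C : Set (ℝ × ℝ)} (hC : Convex ℝ C) (hne : C.Nonempty) {m : ℝ}
    (hm : ∀ x ∈ C, x.1 ≤ m ∨ x.2 ≤ m) :
    ∃ p : ℝ, 0 ≤ p ∧ p ≤ 1 ∧ ∀ x ∈ C, p * x.1 + (1 - p) * x.2 ≤ m := by
  have hQ : Convex ℝ (Ioi m ×ˢ Ioi m) := (convex_Ioi m).prod (convex_Ioi m)
  have hQo : IsOpen (Ioi m ×ˢ Ioi m) := isOpen_Ioi.prod isOpen_Ioi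
  have hdisj : Disjoint C (Ioi m ×ˢ Ioi m) := by
    rw [Set.disjoint_left]
    rintro x hx ⟨h1, h2⟩
    rcases hm x hx with h | h
    · exact absurd h1 (not_lt.2 h)
    · exact absurd h2 (not_lt.2 h)
  obtain ⟨f, u, hf, hu⟩ := geometric_hahn_banach_open hQ hQo hC hdisj.symm
  obtain ⟨α, hα⟩ : ∃ α, α = -f (1, 0) := ⟨_, rfl⟩
  obtain ⟨β, hβ⟩ : ∃ β, β = -f (0, 1) := ⟨_, rfl⟩
  have hfx : ∀ a b : ℝ, f (a, b) = -(α * a + β * b) := by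
    intro a b
    have : ((a, b) : ℝ × ℝ) = a • (1, 0) + b • (0, 1) := by simp
    rw [this, map_add, map_smul, map_smul, hα, hβ]
    simp only [smul_eq_mul]; ring
  have hf' : ∀ a b : ℝ, 0 < a → 0 < b → -u < α * (m + a) + β * (m + b) := by
    intro a b ha hb
    have := hf (m + a, m + b) ⟨by simpa using ha, by simpa using hb⟩
    rw [hfx] at this; linarith
  have hu' : ∀ x ∈ C, α * x.1 + β * x.2 ≤ -u := by
    intro x hx
    have := hu x hx
    rw [show x = (x.1, x.2) from rfl, hfx] at this; linarith
  -- The quadrant is unbounded in both directions: a negative coefficient would violate the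
  -- separation far out along its axis.
  have hα0 : 0 ≤ α := by
    by_contra! h
    have h1 := hf' (1 + |(α + β) * m + β + u| / (-α)) 1 (by
      have : 0 < -α := by linarith
      positivity) one_pos
    have h2 : α * (|(α + β) * m + β + u| / (-α)) = -|(α + β) * m + β + u| := by
      rw [div_neg, mul_neg, mul_div_cancel₀ _ h.ne]
    have := le_abs_self ((α + β) * m + β + u)
    nlinarith
  have hβ0 : 0 ≤ β := by
    by_contra! h
    have h1 := hf' 1 (1 + |(α + β) * m + α + u| / (-β)) one_pos (by
      have : 0 < -β := by linarith
      positivity)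
    have h2 : β * (|(α + β) * m + α + u| / (-β)) = -|(α + β) * m + α + u| := by
      rw [div_neg, mul_neg, mul_div_cancel₀ _ h.ne]
    have := le_abs_self ((α + β) * m + α + u)
    nlinarith
  have hpos : 0 < α + β := by
    obtain ⟨x, hx⟩ := hne
    have h1 := hu' x hx
    rcases (add_nonneg hα0 hβ0).lt_or_eq with h | h
    · exact h
    · have ha : α = 0 := by linarith
      have hb : β = 0 := by linarith
      have := hf' 1 1 one_pos one_pos
      rw [ha, hb] at this h1
      linarith
  have hlim : -u ≤ (α + β) * m := by
    refine le_of_forall_pos_lt_add fun ε hε => ?_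
    have := hf' (ε / (α + β)) (ε / (α + β)) (by positivity) (by positivity)
    have h2 : (α + β) * (ε / (α + β)) = ε := by field_simp
    nlinarith
  refine ⟨α / (α + β), by positivity, (div_le_one hpos).2 (by linarith), fun x hx => ?_⟩
  have h1 := (hu' x hx).trans hlim
  have h2 : α / (α + β) * x.1 + (1 - α / (α + β)) * x.2 = (α * x.1 + β * x.2) / (α + β) := by
    field_simp; ring
  rw [h2, div_le_iff₀ hpos]; linarith

theorem EReal.exists_coe_le {x : EReal} (h : x ≠ ⊤) : ∃ c : ℝ, x ≤ c := by
  induction x with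
  | bot => exact ⟨0, bot_le⟩
  | coe a => exact ⟨a, le_rfl⟩
  | top => exact absurd rfl h

theorem EReal.le_of_forall_coe {x y : EReal} (h : ∀ c : ℝ, y ≤ c → x ≤ c) : x ≤ y := by
  induction y with
  | bot =>
    induction x with
    | bot => exact le_rfl
    | coe a =>
      have := h (a - 1) bot_le
      rw [EReal.coe_le_coe_iff] at this; linarith
    | top => exact absurd (h 0 bot_le) (by simp)
  | coe a => exact h a le_rfl
  | top => exact le_top

/-! ### The conjugate `ψ*` and Fenchel--Moreau duality -/

namespace IsDivergenceGenerator

variable {φ : ℝ → EReal}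

/-- Running over real points `(x, v)` of the epigraph of `φ` keeps extended-real arithmetic out of
everything that follows. -/
theorem psiConj_le_coe_iff (hφ : IsDivergenceGenerator φ) {y c : ℝ} :
    psiConj φ y ≤ c ↔ ∀ x v : ℝ, φ x ≤ v → (x - 1) * y - v ≤ c := by
  simp only [psiConj, conjOn, mem_univ, iSup_pos, iSup_le_iff]
  constructor
  · intro h x v hv
    have h1 := h (x - 1)
    rw [sub_add_cancel] at h1
    have h2 : (((x - 1) * y : ℝ) : EReal) - (v : EReal) ≤ c :=
      (EReal.sub_le_sub le_rfl hv).trans h1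
    exact_mod_cast h2
  · intro h x
    have h0 := hφ.nonneg (x + 1)
    have h1 := h (x + 1)
    generalize φ (x + 1) = z at *
    induction z with
    | bot => simp at h0
    | coe a =>
      have := h1 a le_rfl
      rw [add_sub_cancel_right] at this
      exact_mod_cast this
    | top => simp

theorem psiConj_nonneg (hφ : IsDivergenceGenerator φ) (y : ℝ) : 0 ≤ psiConj φ y := by
  refine EReal.le_of_forall_coe fun c hc => ?_
  have := (hφ.psiConj_le_coe_iff.1 hc) 1 0 (by simp [hφ.map_one])
  exact_mod_cast (by linarith : (0 : ℝ) ≤ c)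

/-- Only `x ≥ 0` and `φ ≥ 0` enter the supremum, and `(x - 1) y ≤ -y` there. This finiteness of `ψ*`
on a half-line is what makes `h` finite. -/
theorem psiConj_le_neg (hφ : IsDivergenceGenerator φ) {y : ℝ} (hy : y ≤ 0) :
    psiConj φ y ≤ ((-y : ℝ) : EReal) := by
  rw [hφ.psiConj_le_coe_iff]
  intro x v hv
  have hx : 0 ≤ x := by
    by_contra! h
    rw [hφ.eq_top_of_neg x h] at hv
    simp at hv
  have hv0 : 0 ≤ v := by exact_mod_cast (hφ.nonneg x).trans hv
  nlinarith

theorem psiConj_convex (hφ : IsDivergenceGenerator φ) :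
    Convex ℝ {p : ℝ × ℝ | psiConj φ p.1 ≤ (p.2 : EReal)} := by
  rintro ⟨y, c⟩ hy ⟨z, d⟩ hz a b ha hb hab
  simp only [mem_ofPred_eq, hφ.psiConj_le_coe_iff, Prod.smul_mk, Prod.mk_add_mk,
    smul_eq_mul] at *
  intro x v hv
  have h1 := mul_le_mul_of_nonneg_left (hy x v hv) ha
  have h2 := mul_le_mul_of_nonneg_left (hz x v hv) hb
  have h3 : v = a * v + b * v := by rw [← add_mul, hab, one_mul]
  linarith

theorem psiConj_combo_le (hφ : IsDivergenceGenerator φ) {y z c d a b : ℝ}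
    (hy : psiConj φ y ≤ c) (hz : psiConj φ z ≤ d) (ha : 0 ≤ a) (hb : 0 ≤ b) (hab : a + b = 1) :
    psiConj φ (a * y + b * z) ≤ ((a * c + b * d : ℝ) : EReal) :=
  hφ.psiConj_convex (x := (y, c)) hy (y := (z, d)) hz ha hb hab

/-- For each `u` the constraint is affine in the dual variable, so the sign of `u - 1` decides which
endpoint implies it. -/
theorem psiConj_sublevel_ordConnected (hφ : IsDivergenceGenerator φ) {y z x c : ℝ}
    (hy : psiConj φ y ≤ c) (hz : psiConj φ z ≤ c) (hx : x ∈ Icc y z) : psiConj φ x ≤ c := by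
  rw [hφ.psiConj_le_coe_iff] at *
  intro u v hv
  have h1 := hy u v hv
  have h2 := hz u v hv
  rcases le_total 1 u with h | h
  · have := mul_le_mul_of_nonneg_left hx.2 (sub_nonneg.2 h)
    linarith
  · have := mul_le_mul_of_nonneg_left hx.1 (sub_nonneg.2 h)
    linarith

theorem isClosed_psiConj_sublevel (hφ : IsDivergenceGenerator φ) (c : ℝ) :
    IsClosed {y | psiConj φ y ≤ c} := by
  simp only [hφ.psiConj_le_coe_iff, ofPred_forall]
  refine isClosed_iInter fun x => isClosed_iInter fun v => isClosed_iInter fun _ => ?_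
  exact isClosed_le (by fun_prop) continuous_const

/-- Since `φ` is finite on both sides of `1`, `ψ*` dominates one affine function of positive slope
and one of negative slope. -/
theorem exists_psiConj_coercive (hφ : IsDivergenceGenerator φ) :
    ∃ δ > 0, ∃ C : ℝ, ∀ y c : ℝ, psiConj φ y ≤ c → δ * |y| ≤ c + C := by
  obtain ⟨δ, hδ, hball⟩ := Metric.mem_nhds_iff.1 hφ.dom_mem_nhds
  have h1 : φ (1 + δ / 2) ≠ ⊤ :=
    (hball (by rw [Metric.mem_ball, Real.dist_eq, add_sub_cancel_left, abs_of_pos] <;> linarith)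
      : φ (1 + δ / 2) < ⊤).ne
  have h2 : φ (1 - δ / 2) ≠ ⊤ :=
    (hball (by rw [Metric.mem_ball, Real.dist_eq, sub_sub_cancel_left, abs_neg, abs_of_pos]
               <;> linarith) : φ (1 - δ / 2) < ⊤).ne
  obtain ⟨C1, hC1⟩ := EReal.exists_coe_le h1
  obtain ⟨C2, hC2⟩ := EReal.exists_coe_le h2
  refine ⟨δ / 2, half_pos hδ, max C1 C2, fun y c hc => ?_⟩
  rw [hφ.psiConj_le_coe_iff] at hc
  have h3 := hc _ _ hC1
  have h4 := hc _ _ hC2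
  have h5 := le_max_left C1 C2
  have h6 := le_max_right C1 C2
  rcases abs_cases y with ⟨h, _⟩ | ⟨h, _⟩ <;> rw [h] <;> linarith

/-- If `φ'(∞) < r < y`, then eventually `φ x < r x`, and `(x - 1) y - r x` grows without bound. The
threshold `(y + c) / (y - r)` is where it passes `c`. -/
theorem le_recession (hφ : IsDivergenceGenerator φ) {y c : ℝ} (hc : psiConj φ y ≤ c) :
    (y : EReal) ≤ recession φ := by
  by_contra! h
  obtain ⟨r, hr1, hr2⟩ := EReal.lt_iff_exists_real_btwn.1 h
  have hr2' : r < y := by exact_mod_cast hr2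
  have hev : ∀ᶠ x : ℝ in atTop, φ x / (x : EReal) < r := eventually_lt_of_limsup_lt hr1
  have hev2 : ∀ᶠ x : ℝ in atTop, (y + c) / (y - r) < x := eventually_gt_atTop _
  obtain ⟨x, hx1, hx2, hx0⟩ := (hev.and (hev2.and (eventually_gt_atTop 0))).exists
  rw [EReal.div_lt_iff (by exact_mod_cast hx0) (by simp)] at hx1
  have h1 := hφ.psiConj_le_coe_iff.1 hc x (r * x) (by exact_mod_cast hx1.le)
  rw [div_lt_iff₀ (by linarith)] at hx2
  linarith

/-- Fenchel--Moreau duality for `φ`, in terms of the conjugate of `x ↦ φ (x + 1)`. -/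
theorem le_of_forall_psiConj (hφ : IsDivergenceGenerator φ) {x a : ℝ}
    (h : ∀ y c : ℝ, psiConj φ y ≤ c → (x - 1) * y - c ≤ a) : φ x ≤ a := by
  by_contra! hlt
  have hcl : IsClosed {p : ℝ × ℝ | φ p.1 ≤ (p.2 : EReal)} :=
    hφ.lsc.isClosed_epigraph.preimage
      (continuous_fst.prodMk (continuous_coe_real_ereal.comp continuous_snd))
  obtain ⟨f, u, hf, hu⟩ := geometric_hahn_banach_closed_point hφ.convex hcl
    (x := (x, a)) (by simpa using hlt)
  obtain ⟨α, hα⟩ : ∃ α, α = f (1, 0) := ⟨_, rfl⟩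
  obtain ⟨k, hk⟩ : ∃ k, k = -f (0, 1) := ⟨_, rfl⟩
  have hfx : ∀ s t : ℝ, f (s, t) = α * s - k * t := by
    intro s t
    have : ((s, t) : ℝ × ℝ) = s • (1, 0) + t • (0, 1) := by simp
    rw [this, map_add, map_smul, map_smul, hα, hk]
    simp only [smul_eq_mul]; ring
  rw [hfx] at hu
  have hf' : ∀ s t : ℝ, φ s ≤ t → α * s - k * t < u := fun s t hst => hfx s t ▸ hf (s, t) hst
  have hk0 : 0 ≤ k := by
    by_contra! hk0
    have h1 := hf' 1 (|u - α| / (-k)) (by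
      rw [hφ.map_one]
      have : 0 < -k := by linarith
      exact_mod_cast (by positivity : 0 ≤ |u - α| / (-k)))
    rw [div_neg, mul_neg, mul_div_cancel₀ _ hk0.ne] at h1
    linarith [le_abs_self (u - α)]
  rcases hk0.eq_or_lt with hk0 | hk0
  -- Vertical hyperplane: it separates `x` from the domain of `φ`. As `φ ≥ 0`, every multiple `n α`
  -- satisfies `ψ*(n α) ≤ n (u - α)`, and a large `n` contradicts the bound by `a`.
  · rw [← hk0] at hu hf'
    simp only [zero_mul, sub_zero] at hu hf'
    have hα1 : α * 1 < u := hf' 1 0 (by simp [hφ.map_one])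
    have hy : ∀ n : ℝ, 0 ≤ n → (x - 1) * (n * α) - n * (u - α) ≤ a := by
      intro n hn
      refine h _ _ (hφ.psiConj_le_coe_iff.2 fun s v hv => ?_)
      have h1 := mul_le_mul_of_nonneg_left (hf' s v hv).le hn
      have h2 : 0 ≤ v := by exact_mod_cast (hφ.nonneg s).trans hv
      linarith
    have hd : 0 < α * x - u := by linarith
    have h1 := hy ((|a| + 1) / (α * x - u)) (by positivity)
    have h2 : (|a| + 1) / (α * x - u) * (α * x - u) = |a| + 1 := div_mul_cancel₀ _ hd.ne'
    linarith [le_abs_self a]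
  -- Non-vertical hyperplane: it is the graph of an affine minorant of `φ` with slope `α / k`.
  · have h1 := h (α / k) (u / k - α / k) (hφ.psiConj_le_coe_iff.2 fun s v hv => by
      have h2 := hf' s v hv
      have h3 : (s - 1) * (α / k) - v = (α * s - k * v) / k - α / k := by field_simp; ring
      rw [h3]
      gcongr)
    have h3 : (x - 1) * (α / k) - (u / k - α / k) = (α * x - u) / k := by ring
    rw [h3, div_le_iff₀ hk0] at h1
    linarith

/-- Converse of `le_recession`: a bound `M` on the domain of `ψ*` gives `φ x ≤ M x` for `x ≥ 1` by
biconjugation. -/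
theorem recession_le (hφ : IsDivergenceGenerator φ) {M : ℝ}
    (h : ∀ y c : ℝ, psiConj φ y ≤ c → y ≤ M) : recession φ ≤ M := by
  have h0 : 0 ≤ M := h 0 0 (by simpa using hφ.psiConj_le_neg le_rfl)
  refine limsup_le_of_le (by isBoundedDefault) ?_
  filter_upwards [eventually_ge_atTop 1] with x hx
  have hx0 : 0 < x := by linarith
  have h1 : φ x ≤ ((M * x : ℝ) : EReal) := hφ.le_of_forall_psiConj fun y c hc => by
    have h2 : 0 ≤ c := by exact_mod_cast (hφ.psiConj_nonneg y).trans hc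
    have h3 := mul_le_mul_of_nonneg_left (h y c hc) (sub_nonneg.2 hx)
    nlinarith
  rw [EReal.div_le_iff_le_mul (by exact_mod_cast hx0) (by simp)]
  rw [mul_comm] at h1
  exact_mod_cast h1

end IsDivergenceGenerator

/-! ### The height-for-width function -/

theorem heightForWidth_nonneg (f : ℝ → EReal) (w : ℝ) : 0 ≤ heightForWidth f w :=
  le_sInf fun _ h => h.1

theorem heightForWidth_mono (f : ℝ → EReal) : Monotone (heightForWidth f) :=
  fun _ _ hwv => sInf_le_sInf fun _ h => ⟨h.1, (ENNReal.ofReal_le_ofReal hwv).trans h.2⟩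

namespace IsDivergenceGenerator

variable {φ : ℝ → EReal}

theorem heightForWidth_le (hφ : IsDivergenceGenerator φ) {w l c : ℝ}
    (h1 : psiConj φ (l + w / 2) ≤ c) (h2 : psiConj φ (l - w / 2) ≤ c) :
    heightForWidth (psiConj φ) w ≤ c := by
  refine sInf_le ⟨(hφ.psiConj_nonneg _).trans h1, ?_⟩
  have hsub : Icc (l - w / 2) (l + w / 2) ⊆ {x | psiConj φ x ≤ c} :=
    fun x hx => hφ.psiConj_sublevel_ordConnected h2 h1 hx
  have := measure_mono (μ := volume) hsub
  rw [Real.volume_Icc] at this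
  exact (ENNReal.ofReal_le_ofReal (by linarith)).trans this

/-- The sublevel set is a compact interval containing `0`, so its volume is its length and its
midpoint can serve as `l`. -/
theorem exists_psiConj_le_of_le_sublevelVolume (hφ : IsDivergenceGenerator φ) {w c : ℝ}
    (hc : 0 ≤ c) (h : ENNReal.ofReal w ≤ sublevelVolume (psiConj φ) c) (hw : 0 ≤ w) :
    ∃ l, psiConj φ (l + w / 2) ≤ c ∧ psiConj φ (l - w / 2) ≤ c := by
  have hz : (0 : ℝ) ∈ {x | psiConj φ x ≤ c} :=
    (hφ.psiConj_le_neg le_rfl).trans (by simpa using hc)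
  have hord : OrdConnected {x | psiConj φ x ≤ c} :=
    ⟨fun y hy z hz x hx => hφ.psiConj_sublevel_ordConnected hy hz hx⟩
  obtain ⟨δ, hδ, C, hC⟩ := hφ.exists_psiConj_coercive
  have hcpt : IsCompact {x | psiConj φ x ≤ c} := by
    refine (isCompact_Icc (a := -((c + C) / δ)) (b := (c + C) / δ)).of_isClosed_subset
      (hφ.isClosed_psiConj_sublevel c) fun x hx => ?_
    rw [mem_Icc, ← abs_le, le_div_iff₀ hδ, mul_comm]
    exact hC x c hx
  have hconn : IsConnected {x | psiConj φ x ≤ c} := ⟨⟨0, hz⟩, hord.isPreconnected⟩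
  have heq := eq_Icc_of_connected_compact hconn hcpt
  rw [sublevelVolume, heq, Real.volume_Icc] at h
  generalize sInf {x | psiConj φ x ≤ c} = a at *
  generalize sSup {x | psiConj φ x ≤ c} = b at *
  have hab : a ≤ b := by
    rw [heq] at hz; exact hz.1.trans hz.2
  rw [ENNReal.ofReal_le_ofReal_iff (by linarith)] at h
  have hmem : ∀ x ∈ Icc a b, psiConj φ x ≤ c := fun x hx => by rw [← heq] at hx; exact hx
  exact ⟨(a + b) / 2, hmem _ ⟨by linarith, by linarith⟩, hmem _ ⟨by linarith, by linarith⟩⟩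

theorem exists_of_heightForWidth_lt (hφ : IsDivergenceGenerator φ) {w c : ℝ}
    (hw : 0 ≤ w) (h : heightForWidth (psiConj φ) w < c) :
    ∃ l, psiConj φ (l + w / 2) ≤ c ∧ psiConj φ (l - w / 2) ≤ c := by
  obtain ⟨s, ⟨hs0, hs⟩, hsc⟩ := sInf_lt_iff.1 h
  refine hφ.exists_psiConj_le_of_le_sublevelVolume (by exact_mod_cast hs0.trans hsc.le)
    (hs.trans ?_) hw
  exact measure_mono fun x (hx : _ ≤ s) => hx.trans hsc.le

theorem heightForWidth_le_self (hφ : IsDivergenceGenerator φ) {w : ℝ} (hw : 0 ≤ w) :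
    heightForWidth (psiConj φ) w ≤ w := by
  -- The interval `[-w, 0]`, on which `ψ*(y) ≤ -y ≤ w`.
  refine hφ.heightForWidth_le (l := -(w / 2)) ?_ ?_
  · refine (hφ.psiConj_le_neg (by linarith)).trans ?_
    exact_mod_cast (by linarith : -(-(w / 2) + w / 2) ≤ w)
  · refine (hφ.psiConj_le_neg (by linarith)).trans ?_
    exact_mod_cast (by linarith : -(-(w / 2) - w / 2) ≤ w)

theorem heightForWidth_ne_top (hφ : IsDivergenceGenerator φ) {w : ℝ} (hw : 0 ≤ w) :
    heightForWidth (psiConj φ) w ≠ ⊤ :=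
  ((hφ.heightForWidth_le_self hw).trans_lt (EReal.coe_lt_top w)).ne

theorem heightForWidth_ne_bot (φ : ℝ → EReal) (w : ℝ) : heightForWidth (psiConj φ) w ≠ ⊥ :=
  (EReal.bot_lt_zero.trans_le (heightForWidth_nonneg _ w)).ne'

theorem coe_toReal_heightForWidth (hφ : IsDivergenceGenerator φ) {w : ℝ} (hw : 0 ≤ w) :
    ((heightForWidth (psiConj φ) w).toReal : EReal) = heightForWidth (psiConj φ) w :=
  EReal.coe_toReal (hφ.heightForWidth_ne_top hw) (heightForWidth_ne_bot φ w)

theorem heightForWidth_eq_iInf (hφ : IsDivergenceGenerator φ) {w : ℝ} (hw : 0 ≤ w) :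
    heightForWidth (psiConj φ) w =
      ⨅ l : ℝ, max (psiConj φ (l + w / 2)) (psiConj φ (l - w / 2)) := by
  refine le_antisymm (le_iInf fun l => EReal.le_of_forall_coe fun c hc => ?_) ?_
  · exact hφ.heightForWidth_le ((le_max_left _ _).trans hc) ((le_max_right _ _).trans hc)
  · by_contra! h
    obtain ⟨c, hc1, hc2⟩ := EReal.lt_iff_exists_real_btwn.1 h
    obtain ⟨l, h1, h2⟩ := hφ.exists_of_heightForWidth_lt hw hc1
    exact absurd (iInf_le_of_le l (max_le h1 h2)) (not_le.2 hc2)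

theorem toReal_heightForWidth_le (hφ : IsDivergenceGenerator φ) {y z c d : ℝ}
    (hy : psiConj φ y ≤ c) (hz : psiConj φ z ≤ d) :
    (heightForWidth (psiConj φ) |y - z|).toReal ≤ max c d := by
  have hy' : psiConj φ y ≤ ((max c d : ℝ) : EReal) := hy.trans (by exact_mod_cast le_max_left c d)
  have hz' : psiConj φ z ≤ ((max c d : ℝ) : EReal) := hz.trans (by exact_mod_cast le_max_right c d)
  have h : heightForWidth (psiConj φ) |y - z| ≤ ((max c d : ℝ) : EReal) := by
    refine hφ.heightForWidth_le (l := (y + z) / 2) ?_ ?_ <;>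
    rcases abs_cases (y - z) with ⟨h, _⟩ | ⟨h, _⟩ <;> rw [h] <;> ring_nf <;> assumption
  rw [← hφ.coe_toReal_heightForWidth (abs_nonneg _)] at h
  exact_mod_cast h

/-- Near-optimal centres for `w` and `v`, combined with weights `a` and `b`, give a near-optimal
centre for the combined width. -/
theorem toReal_heightForWidth_convex (hφ : IsDivergenceGenerator φ) :
    ConvexOn ℝ (Ici 0) fun w => (heightForWidth (psiConj φ) w).toReal := by
  refine ⟨convex_Ici 0, fun w hw v hv a b ha hb hab => ?_⟩
  refine le_of_forall_pos_le_add fun ε hε => ?_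
  have key : ∀ w : ℝ, 0 ≤ w → ∃ l, psiConj φ (l + w / 2) ≤
      (((heightForWidth (psiConj φ) w).toReal + ε : ℝ) : EReal) ∧ psiConj φ (l - w / 2) ≤
      (((heightForWidth (psiConj φ) w).toReal + ε : ℝ) : EReal) := fun w hw => by
    refine hφ.exists_of_heightForWidth_lt hw ?_
    rw [← hφ.coe_toReal_heightForWidth hw]
    exact_mod_cast (lt_add_of_pos_right _ hε)
  obtain ⟨l, h1, h2⟩ := key w hw
  obtain ⟨k, h3, h4⟩ := key v hv
  have h5 := hφ.psiConj_combo_le h1 h3 ha hb hab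
  have h6 := hφ.psiConj_combo_le h2 h4 ha hb hab
  have hnn : 0 ≤ a * w + b * v := add_nonneg (mul_nonneg ha hw) (mul_nonneg hb hv)
  have h7 := hφ.toReal_heightForWidth_le h5 h6
  rw [max_self, show a * (l + w / 2) + b * (k + v / 2) - (a * (l - w / 2) + b * (k - v / 2)) =
    a * w + b * v by ring, abs_of_nonneg hnn] at h7
  simp only [smul_eq_mul]
  have h8 : ε = a * ε + b * ε := by rw [← add_mul, hab, one_mul]
  linarith

theorem conjOn_heightForWidth_le_coe_iff (hφ : IsDivergenceGenerator φ) {y m : ℝ} :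
    conjOn (Ici 0) (heightForWidth (psiConj φ)) y ≤ m ↔
      ∀ w : ℝ, 0 ≤ w → w * y - (heightForWidth (psiConj φ) w).toReal ≤ m := by
  simp only [conjOn, iSup_le_iff, mem_Ici]
  refine forall₂_congr fun w hw => ?_
  rw [← hφ.coe_toReal_heightForWidth hw, EReal.toReal_coe]
  norm_cast

theorem heightForWidth_zero (hφ : IsDivergenceGenerator φ) :
    heightForWidth (psiConj φ) 0 = 0 :=
  le_antisymm (by simpa using hφ.heightForWidth_le_self le_rfl) (heightForWidth_nonneg _ _)

theorem conjOn_heightForWidth_nonneg (hφ : IsDivergenceGenerator φ) (y : ℝ) :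
    0 ≤ conjOn (Ici 0) (heightForWidth (psiConj φ)) y := by
  refine EReal.le_of_forall_coe fun c hc => ?_
  have := hφ.conjOn_heightForWidth_le_coe_iff.1 hc 0 le_rfl
  rw [hφ.heightForWidth_zero] at this
  exact_mod_cast (by simpa using this : 0 ≤ c)

/-- This is equality in Fenchel--Young: for convex `h`, a derivative at `x` is a subgradient, so `w
d - h(w)` is maximal at `w = x`. -/
theorem conjOn_heightForWidth_eq_of_hasDerivWithinAt (hφ : IsDivergenceGenerator φ) {x d : ℝ}
    (hx : 0 ≤ x)
    (hd : HasDerivWithinAt (fun w => (heightForWidth (psiConj φ) w).toReal) d (Ici 0) x) :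
    conjOn (Ici 0) (heightForWidth (psiConj φ)) d =
      ((x * d : ℝ) : EReal) - heightForWidth (psiConj φ) x := by
  refine le_antisymm ?_ (le_iSup₂ (f := fun (w : ℝ) (_ : w ∈ Ici (0 : ℝ)) =>
    ((w * d : ℝ) : EReal) - heightForWidth (psiConj φ) w) x hx)
  rw [← hφ.coe_toReal_heightForWidth hx, ← EReal.coe_sub, hφ.conjOn_heightForWidth_le_coe_iff]
  intro w hw
  set H := fun w => (heightForWidth (psiConj φ) w).toReal with hH
  have hconv := hφ.toReal_heightForWidth_convex
  suffices d * (w - x) ≤ H w - H x by simp only [hH] at this; linarith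
  -- Restricting to the segment from `x` to `w` treats `w < x`, `w > x` and the boundary point `x =
  -- 0` alike.
  have hγ : HasDerivWithinAt (fun s : ℝ => x + s * (w - x)) (w - x) (Icc 0 1) 0 := by
    simpa using (((hasDerivAt_id (0 : ℝ)).mul_const (w - x)).const_add x).hasDerivWithinAt
  have hmaps : MapsTo (fun s : ℝ => x + s * (w - x)) (Icc 0 1) (Ici 0) := by
    intro s hs
    have := mul_nonneg hs.1 hw
    have := mul_nonneg (sub_nonneg.2 hs.2) hx
    show 0 ≤ x + s * (w - x)
    linarith
  have hcomp : HasDerivWithinAt (fun s : ℝ => H (x + s * (w - x))) (d * (w - x)) (Icc 0 1) 0 := by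
    refine HasDerivWithinAt.comp (0 : ℝ) (h₂ := H) ?_ hγ hmaps
    simpa using hd
  have hlim := hasDerivWithinAt_iff_tendsto_slope.1 hcomp
  have hne : (𝓝[Icc (0 : ℝ) 1 \ {0}] 0).NeBot := by
    rw [Icc_sdiff_left, nhdsWithin_Ioc_eq_nhdsGT one_pos]
    infer_instance
  refine le_of_tendsto hlim ?_
  filter_upwards [self_mem_nhdsWithin] with s hs
  rw [Icc_sdiff_left] at hs
  have h1 := hconv.2 (x := w) hw (y := x) hx hs.1.le (sub_nonneg.2 hs.2) (by ring)
  simp only [smul_eq_mul] at h1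
  rw [show s * w + (1 - s) * x = x + s * (w - x) by ring] at h1
  rw [slope_def_field, zero_mul, add_zero, sub_zero, div_le_iff₀ hs.1]
  simp only [hH]
  linarith

theorem nonneg_of_hasDerivWithinAt_heightForWidth (hφ : IsDivergenceGenerator φ) {x d : ℝ}
    (hx : 0 ≤ x)
    (hd : HasDerivWithinAt (fun w => (heightForWidth (psiConj φ) w).toReal) d (Ici 0) x) :
    0 ≤ d := by
  have hmono : MonotoneOn (fun w => (heightForWidth (psiConj φ) w).toReal) (Ici 0) :=
    fun a ha b hb hab => EReal.toReal_le_toReal (heightForWidth_mono _ hab)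
      (heightForWidth_ne_bot φ a) (hφ.heightForWidth_ne_top hb)
  have := hmono.derivWithin_nonneg (x := x)
  rwa [hd.derivWithin (uniqueDiffOn_Ici 0 x hx)] at this

/-! ### Saddle points and optimal weights -/

/-- The saddle point of `∫ ψ*(t g + l) dν` over two-point measures `ν` and `l ∈ ℝ`. -/
theorem exists_weight_heightForWidth_le (hφ : IsDivergenceGenerator φ) {t : ℝ} (ht : 0 ≤ t) :
    ∃ p : ℝ, 0 ≤ p ∧ p ≤ 1 ∧ ∀ l c d : ℝ, psiConj φ (t + l) ≤ c → psiConj φ (-t + l) ≤ d →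
      (heightForWidth (psiConj φ) (2 * t)).toReal ≤ p * c + (1 - p) * d := by
  have key := exists_convexCombination_le
    (C := {x : ℝ × ℝ | ∃ l, psiConj φ (t + l) ≤ ((-x.1 : ℝ) : EReal) ∧
      psiConj φ (-t + l) ≤ ((-x.2 : ℝ) : EReal)})
    (m := -(heightForWidth (psiConj φ) (2 * t)).toReal) ?convex ?nonempty ?bound
  case convex =>
    rintro x ⟨l, h1, h2⟩ y ⟨k, h3, h4⟩ a b ha hb hab
    have h5 := hφ.psiConj_combo_le h1 h3 ha hb hab
    have h6 := hφ.psiConj_combo_le h2 h4 ha hb hab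
    refine ⟨a * l + b * k, ?_, ?_⟩
    · convert h5 using 2
      · linear_combination -t * hab
      · simp; ring
    · convert h6 using 2
      · linear_combination t * hab
      · simp; ring
  case nonempty =>
    refine ⟨(-(2 * t), -(2 * t)), -t, ?_, ?_⟩ <;>
    · refine (hφ.psiConj_le_neg (by linarith)).trans ?_
      simp only [EReal.coe_le_coe_iff]; linarith
  case bound =>
    rintro x ⟨l, h1, h2⟩
    have h3 := hφ.toReal_heightForWidth_le h1 h2
    rw [show t + l - (-t + l) = 2 * t by ring, abs_of_nonneg (by linarith)] at h3
    rcases le_max_iff.1 h3 with h | h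
    · left; linarith
    · right; linarith
  obtain ⟨p, hp0, hp1, hp⟩ := key
  refine ⟨p, hp0, hp1, fun l c d hc hd => ?_⟩
  have := hp (-c, -d) ⟨l, by simpa using hc, by simpa using hd⟩
  simp only at this
  linarith

/-- Minimax applied to `δ (y - z) - max (ψ* y) (ψ* z)`, which is at most `δ |y - z| - h(|y - z|) ≤
h*(δ)`. The weight `p` does not depend on `(y, z)`, so the suprema over `y` and `z` can then be
taken separately. -/
theorem exists_weight_le_of_conjOn_le (hφ : IsDivergenceGenerator φ) {δ m : ℝ} (hδ : 0 ≤ δ)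
    (h : conjOn (Ici 0) (heightForWidth (psiConj φ)) δ ≤ m) :
    ∃ p : ℝ, 0 ≤ p ∧ p ≤ 1 ∧ ∀ y z c d : ℝ, psiConj φ y ≤ c → psiConj φ z ≤ d →
      δ * (y - z) - (p * c + (1 - p) * d) ≤ m := by
  rw [hφ.conjOn_heightForWidth_le_coe_iff] at h
  have key := exists_convexCombination_le
    (C := {x : ℝ × ℝ | ∃ y z, psiConj φ y ≤ ((δ * (y - z) - x.1 : ℝ) : EReal) ∧
      psiConj φ z ≤ ((δ * (y - z) - x.2 : ℝ) : EReal)})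
    (m := m) ?convex ?nonempty ?bound
  case convex =>
    rintro x ⟨y, z, h1, h2⟩ x' ⟨y', z', h3, h4⟩ a b ha hb hab
    have h5 := hφ.psiConj_combo_le h1 h3 ha hb hab
    have h6 := hφ.psiConj_combo_le h2 h4 ha hb hab
    refine ⟨a * y + b * y', a * z + b * z', ?_, ?_⟩
    · convert h5 using 2
      simp; ring
    · convert h6 using 2
      simp; ring
  case nonempty =>
    refine ⟨(0, 0), 0, 0, ?_⟩
    have := hφ.psiConj_le_neg (le_refl 0)
    simpa using this
  case bound =>
    rintro x ⟨y, z, h1, h2⟩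
    have h3 := hφ.toReal_heightForWidth_le h1 h2
    have h4 := h |y - z| (abs_nonneg _)
    have h5 := mul_le_mul_of_nonneg_left (le_abs_self (y - z)) hδ
    rcases le_max_iff.1 h3 with h | h
    · left; linarith
    · right; linarith
  obtain ⟨p, hp0, hp1, hp⟩ := key
  refine ⟨p, hp0, hp1, fun y z c d hc hd => ?_⟩
  have := hp (δ * (y - z) - c, δ * (y - z) - d) ⟨y, z, by simpa using hc, by simpa using hd⟩
  simp only at this
  linarith

/-- Two-point distributions, possibly with a singular part, attain the conjugate of the
height-for-width function. -/
theorem exists_twoPoint_le_of_conjOn_le (hφ : IsDivergenceGenerator φ) {δ m : ℝ} (hδ : 0 < δ)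
    (h : conjOn (Ici 0) (heightForWidth (psiConj φ)) δ ≤ m) :
    (∃ p u v : ℝ, 0 < p ∧ p < 1 ∧ φ (1 + δ / p) ≤ u ∧ φ (1 - δ / (1 - p)) ≤ v ∧
      p * u + (1 - p) * v ≤ m) ∨
    (∃ M v : ℝ, recession φ ≤ M ∧ φ (1 - δ) ≤ v ∧ δ * M + v ≤ m) := by
  obtain ⟨p, hp0, hp1, hp⟩ := hφ.exists_weight_le_of_conjOn_le hδ.le h
  have hz : psiConj φ 0 ≤ (0 : ℝ) := by simpa using hφ.psiConj_le_neg (le_refl 0)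
  rcases hp0.eq_or_lt with rfl | hp0
  -- With `p = 0` the variable `y` is bounded only by the domain of `ψ*`, whose supremum is `φ'(∞)`:
  -- this is the singular case.
  · right
    have hrec : ∀ z d : ℝ, psiConj φ z ≤ d → recession φ ≤ (((m + d) / δ + z : ℝ) : EReal) := by
      intro z d hd
      refine hφ.recession_le fun y c hc => ?_
      have := hp y z c d hc hd
      rw [← sub_le_iff_le_add, le_div_iff₀ hδ]
      linarith
    have hr0 : 0 ≤ recession φ := by simpa using hφ.le_recession hz
    have hr1 := hrec 0 0 hz
    generalize recession φ = r at *
    induction r with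
    | bot => simp at hr0
    | top => simp only [top_le_iff, EReal.coe_ne_top] at hr1
    | coe M =>
      refine ⟨M, m - δ * M, le_rfl, hφ.le_of_forall_psiConj fun z d hd => ?_, by linarith⟩
      have h1 : M ≤ (m + d) / δ + z := by exact_mod_cast hrec z d hd
      rw [← sub_le_iff_le_add, le_div_iff₀ hδ] at h1
      linarith
  rcases hp1.eq_or_lt with rfl | hp1
  -- With `p = 1` the value at `z` costs nothing, and `z → -∞` makes `δ (y - z)` exceed `m`.
  · exfalso
    have h1 := hp 0 (-((|m| + 1) / δ)) 0 _ hz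
      (hφ.psiConj_le_neg (neg_nonpos.2 (by positivity)))
    have h2 : δ * (0 - -((|m| + 1) / δ)) = |m| + 1 := by field_simp; ring
    rw [h2] at h1
    linarith [le_abs_self m]
  left
  have hq : 0 < 1 - p := by linarith
  -- Biconjugation in `y` with `z` fixed, and afterwards in `z`.
  have hu : ∀ z d : ℝ, psiConj φ z ≤ d →
      φ (1 + δ / p) ≤ (((m + δ * z + (1 - p) * d) / p : ℝ) : EReal) := by
    intro z d hd
    refine hφ.le_of_forall_psiConj fun y c hc => ?_
    have := hp y z c d hc hd
    have h3 : ((1 + δ / p) - 1) * y - c = (δ * y - p * c) / p := by field_simp; ring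
    rw [h3]
    gcongr
    linarith
  have hφ0 := hφ.nonneg (1 + δ / p)
  have hφ1 := hu 0 0 hz
  generalize hφr : φ (1 + δ / p) = r at *
  induction r with
  | bot => simp at hφ0
  | top => simp only [top_le_iff, EReal.coe_ne_top] at hφ1
  | coe u =>
    refine ⟨p, u, (m - p * u) / (1 - p), hp0, hp1, hφr.le,
      hφ.le_of_forall_psiConj fun z d hd => ?_, ?_⟩
    · have h1 : u ≤ (m + δ * z + (1 - p) * d) / p := by exact_mod_cast hu z d hd
      rw [le_div_iff₀ hp0] at h1
      have h3 : ((1 - δ / (1 - p)) - 1) * z - d = (-δ * z - (1 - p) * d) / (1 - p) := by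
        field_simp; ring
      rw [h3]
      refine div_le_div_of_nonneg_right ?_ hq.le
      linarith
    · rw [mul_div_cancel₀ _ hq.ne']; linarith

end IsDivergenceGenerator

/-! ### Two-point measures -/

theorem ofReal_integral_le_lintegral_ofReal {α : Type*} [MeasurableSpace α] {μ : Measure α}
    {f : α → ℝ} (hf : Integrable f μ) :
    ENNReal.ofReal (∫ x, f x ∂μ) ≤ ∫⁻ x, ENNReal.ofReal (f x) ∂μ := by
  have h1 : ∫ x, f x ∂μ ≤ ∫ x, max (f x) 0 ∂μ :=
    integral_mono hf hf.pos_part fun x => le_max_left _ _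
  refine (ENNReal.ofReal_le_ofReal h1).trans ?_
  rw [ofReal_integral_eq_lintegral_ofReal hf.pos_part (ae_of_all _ fun x => le_max_right _ _)]
  refine lintegral_mono fun x => ?_
  simp

theorem EReal.ofReal_le_toENNReal {x : EReal} {r : ℝ} (h : (r : EReal) ≤ x) :
    ENNReal.ofReal r ≤ x.toENNReal := by
  have := EReal.toENNReal_le_toENNReal h
  simpa using this

theorem EReal.toENNReal_le_ofReal {x : EReal} {r : ℝ} (h : x ≤ r) :
    x.toENNReal ≤ ENNReal.ofReal r := by
  have := EReal.toENNReal_le_toENNReal h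
  simpa using this

theorem EReal.toENNReal_coe_real (r : ℝ) : (r : EReal).toENNReal = ENNReal.ofReal r := by simp

/-- The function equal to `1` on `A` and to `-1` on the complement of `A`. -/
noncomputable def signOf {Ω : Type*} (A : Set Ω) : Ω → ℝ :=
  fun x => 2 * A.indicator 1 x - 1

theorem signOf_of_mem {Ω : Type*} {A : Set Ω} {x : Ω} (h : x ∈ A) : signOf A x = 1 := by
  simp [signOf, h]; norm_num

theorem signOf_of_notMem {Ω : Type*} {A : Set Ω} {x : Ω} (h : x ∉ A) : signOf A x = -1 := by
  simp [signOf, h]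

section TwoPoint

variable {Ω : Type*} [MeasurableSpace Ω]

/-- The measure with mass `p` at `a` and mass `1 - p` at `b`. -/
noncomputable def twoPoint (p : ℝ) (a b : Ω) : Measure Ω :=
  ENNReal.ofReal p • Measure.dirac a + ENNReal.ofReal (1 - p) • Measure.dirac b

theorem isProbabilityMeasure_twoPoint {p : ℝ} (h0 : 0 ≤ p) (h1 : p ≤ 1) (a b : Ω) :
    IsProbabilityMeasure (twoPoint p a b) := by
  constructor
  simp only [twoPoint, Measure.add_apply, Measure.smul_apply, measure_univ, smul_eq_mul, mul_one]
  rw [← ENNReal.ofReal_add h0 (by linarith)]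
  simp

theorem lintegral_twoPoint (p : ℝ) (a b : Ω) {f : Ω → ℝ≥0∞} (hf : Measurable f) :
    ∫⁻ x, f x ∂(twoPoint p a b) = ENNReal.ofReal p * f a + ENNReal.ofReal (1 - p) * f b := by
  rw [twoPoint, lintegral_add_measure, lintegral_smul_measure, lintegral_smul_measure,
    lintegral_dirac' _ hf, lintegral_dirac' _ hf, smul_eq_mul, smul_eq_mul]

theorem integral_twoPoint {p : ℝ} (h0 : 0 ≤ p) (h1 : p ≤ 1) (a b : Ω) {g : Ω → ℝ}
    (hg : g ∈ unitFunctions Ω) :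
    ∫ x, g x ∂(twoPoint p a b) = p * g a + (1 - p) * g b := by
  have hint : ∀ μ : Measure Ω, IsFiniteMeasure μ → Integrable g μ := fun μ _ =>
    Integrable.of_bound hg.1.aestronglyMeasurable 1
      (ae_of_all _ fun x => by rw [Real.norm_eq_abs, abs_le]; exact hg.2 x)
  rw [twoPoint, integral_add_measure ((hint _ inferInstance).smul_measure ENNReal.ofReal_ne_top)
    ((hint _ inferInstance).smul_measure ENNReal.ofReal_ne_top), integral_smul_measure,
    integral_smul_measure, integral_dirac' _ _ hg.1.stronglyMeasurable,
    integral_dirac' _ _ hg.1.stronglyMeasurable, ENNReal.toReal_ofReal h0,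
    ENNReal.toReal_ofReal (by linarith), smul_eq_mul, smul_eq_mul]

variable {A : Set Ω} {a b : Ω}

/-- Singletons need not be measurable, but an integrand constant on `A` and on its complement is
measurable, whatever `φ` is. -/
theorem lintegral_twoPoint_of_const (hA : MeasurableSet A) (ha : a ∈ A) (hb : b ∉ A) (p : ℝ)
    {f : Ω → ℝ≥0∞} {c d : ℝ≥0∞} (hc : ∀ x ∈ A, f x = c) (hd : ∀ x ∉ A, f x = d) :
    ∫⁻ x, f x ∂(twoPoint p a b) = ENNReal.ofReal p * c + ENNReal.ofReal (1 - p) * d := by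
  classical
  have hf : f = A.piecewise (fun _ => c) (fun _ => d) := by
    funext x
    by_cases hx : x ∈ A
    · rw [piecewise_eq_of_mem _ _ _ hx, hc x hx]
    · rw [piecewise_eq_of_notMem _ _ _ hx, hd x hx]
  have hm : Measurable f := hf ▸ measurable_const.piecewise hA measurable_const
  rw [lintegral_twoPoint p a b hm, hc a ha, hd b hb]

theorem signOf_mem_unitFunctions (hA : MeasurableSet A) : signOf A ∈ unitFunctions Ω := by
  refine ⟨((measurable_one.indicator hA).const_mul 2).sub_const 1, fun x => ?_⟩
  by_cases h : x ∈ A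
  · rw [signOf_of_mem h]; norm_num
  · rw [signOf_of_notMem h]; norm_num

theorem tvDist_twoPoint (hA : MeasurableSet A) (ha : a ∈ A) (hb : b ∉ A) {p δ : ℝ} (hp : 0 ≤ p)
    (hδ : 0 ≤ δ) (h : p + δ ≤ 1) :
    tvDist (twoPoint (p + δ) a b) (twoPoint p a b) = ENNReal.ofReal (2 * δ) := by
  have key : ∀ g ∈ unitFunctions Ω, ∫ x, g x ∂(twoPoint (p + δ) a b) - ∫ x, g x ∂(twoPoint p a b)
      = δ * (g a - g b) := by
    intro g hg
    rw [integral_twoPoint (by linarith) h a b hg, integral_twoPoint hp (by linarith) a b hg]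
    ring
  apply le_antisymm
  · refine iSup₂_le fun g hg => ENNReal.ofReal_le_ofReal ?_
    rw [key g hg, abs_mul, abs_of_nonneg hδ, mul_comm]
    refine mul_le_mul_of_nonneg_right ?_ hδ
    have h1 := hg.2 a
    have h2 := hg.2 b
    rw [abs_le]
    constructor <;> linarith [h1.1, h1.2, h2.1, h2.2]
  · refine le_iSup₂_of_le (signOf A) (signOf_mem_unitFunctions hA) (ENNReal.ofReal_le_ofReal ?_)
    rw [key _ (signOf_mem_unitFunctions hA), signOf_of_mem ha, signOf_of_notMem hb]
    refine le_trans (le_of_eq (by ring)) (le_abs_self _)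

/-- By uniqueness of the Lebesgue decomposition, any explicit decomposition computes the divergence.
-/
theorem phiDiv_add_withDensity (φ : ℝ → EReal) {s ν : Measure Ω} [IsFiniteMeasure ν]
    {f : Ω → ℝ≥0∞} (hf : Measurable f) (hs : s ⟂ₘ ν) :
    phiDiv φ (s + ν.withDensity f) ν =
      ∫⁻ x, (φ (f x).toReal).toENNReal ∂ν + s univ * (recession φ).toENNReal := by
  rw [phiDiv, ← Measure.eq_singularPart hf hs rfl]
  congr 1
  refine lintegral_congr_ae ?_
  filter_upwards [Measure.eq_rnDeriv hf hs rfl] with x hx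
  rw [hx]

theorem twoPoint_withDensity (hA : MeasurableSet A) (ha : a ∈ A) (hb : b ∉ A) {p δ : ℝ}
    (hp : 0 < p) (hp1 : p < 1) [DecidablePred (· ∈ A)] :
    (twoPoint p a b).withDensity (A.piecewise (fun _ => ENNReal.ofReal (1 + δ / p))
      (fun _ => ENNReal.ofReal (1 - δ / (1 - p)))) = twoPoint (p + δ) a b := by
  have hm : Measurable (A.piecewise (fun _ => ENNReal.ofReal (1 + δ / p))
      (fun _ => ENNReal.ofReal (1 - δ / (1 - p)))) :=
    measurable_const.piecewise hA measurable_const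
  have hq : 0 < 1 - p := by linarith
  have e1 : ENNReal.ofReal p * ENNReal.ofReal (1 + δ / p) = ENNReal.ofReal (p + δ) := by
    rw [← ENNReal.ofReal_mul hp.le]; congr 1; field_simp
  have e2 : ENNReal.ofReal (1 - p) * ENNReal.ofReal (1 - δ / (1 - p)) =
      ENNReal.ofReal (1 - (p + δ)) := by
    rw [← ENNReal.ofReal_mul hq.le]; congr 1; field_simp; ring
  ext s hs
  rw [withDensity_apply _ hs, ← lintegral_indicator hs, lintegral_twoPoint p a b (hm.indicator hs),
    twoPoint, Measure.add_apply, Measure.smul_apply, Measure.smul_apply, Measure.dirac_apply' _ hs,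
    Measure.dirac_apply' _ hs, smul_eq_mul, smul_eq_mul, ← e1, ← e2]
  by_cases h1 : a ∈ s <;> by_cases h2 : b ∈ s <;> simp [h1, h2, ha, hb]

/-! ### Vajda's problem -/

namespace IsDivergenceGenerator

variable {φ : ℝ → EReal}

theorem phiDiv_twoPoint_le (hA : MeasurableSet A) (ha : a ∈ A) (hb : b ∉ A)
    {p δ u v : ℝ} (hp : 0 < p) (hp1 : p < 1) (hδ : 0 ≤ δ) (hδ1 : p + δ ≤ 1)
    (hφ : IsDivergenceGenerator φ) (hu : φ (1 + δ / p) ≤ u) (hv : φ (1 - δ / (1 - p)) ≤ v) :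
    phiDiv φ (twoPoint (p + δ) a b) (twoPoint p a b) ≤ ENNReal.ofReal (p * u + (1 - p) * v) := by
  classical
  have hq : 0 < 1 - p := by linarith
  have := isProbabilityMeasure_twoPoint hp.le hp1.le a b
  have hm : Measurable (A.piecewise (fun _ => ENNReal.ofReal (1 + δ / p))
      (fun _ => ENNReal.ofReal (1 - δ / (1 - p)))) :=
    measurable_const.piecewise hA measurable_const
  have hu0 : 0 ≤ u := by exact_mod_cast (hφ.nonneg _).trans hu
  have hv0 : 0 ≤ v := by exact_mod_cast (hφ.nonneg _).trans hv
  have h1 : 0 ≤ 1 + δ / p := by positivity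
  have h2 : 0 ≤ 1 - δ / (1 - p) := by
    rw [sub_nonneg, div_le_one hq]; linarith
  rw [← twoPoint_withDensity hA ha hb hp hp1, ← zero_add (Measure.withDensity _ _),
    phiDiv_add_withDensity φ hm Measure.MutuallySingular.zero_left,
    lintegral_twoPoint_of_const hA ha hb p (c := (φ (1 + δ / p)).toENNReal)
      (d := (φ (1 - δ / (1 - p))).toENNReal), Measure.coe_zero, Pi.zero_apply, zero_mul, add_zero,
    ENNReal.ofReal_add (mul_nonneg hp.le hu0) (mul_nonneg hq.le hv0), ENNReal.ofReal_mul hp.le,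
    ENNReal.ofReal_mul hq.le]
  · gcongr
    · exact EReal.toENNReal_le_ofReal hu
    · exact EReal.toENNReal_le_ofReal hv
  · intro x hx
    rw [piecewise_eq_of_mem _ _ _ hx, ENNReal.toReal_ofReal h1]
  · intro x hx
    rw [piecewise_eq_of_notMem _ _ _ hx, ENNReal.toReal_ofReal h2]

/-- Here `ν` is the Dirac mass at `b`, so the mass `δ` at `a` is singular and is charged at the rate
`φ'(∞)`. -/
theorem phiDiv_twoPoint_zero_le (hA : MeasurableSet A) (ha : a ∈ A) (hb : b ∉ A)
    {δ M v : ℝ} (hδ : 0 ≤ δ) (hδ1 : δ ≤ 1) (hφ : IsDivergenceGenerator φ)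
    (hM : recession φ ≤ M) (hM0 : 0 ≤ M) (hv : φ (1 - δ) ≤ v) :
    phiDiv φ (twoPoint δ a b) (twoPoint 0 a b) ≤ ENNReal.ofReal (δ * M + v) := by
  have := isProbabilityMeasure_twoPoint le_rfl zero_le_one a b
  have hν : twoPoint 0 a b = Measure.dirac b := by simp [twoPoint]
  have hv0 : 0 ≤ v := by exact_mod_cast (hφ.nonneg _).trans hv
  have hs : ENNReal.ofReal δ • Measure.dirac a ⟂ₘ twoPoint 0 a b := by
    refine ⟨Aᶜ, hA.compl, ?_, ?_⟩
    · simp [Measure.dirac_apply' _ hA.compl, ha]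
    · rw [hν, compl_compl, Measure.dirac_apply' _ hA]; simp [hb]
  have hμ : twoPoint δ a b =
      ENNReal.ofReal δ • Measure.dirac a +
        (twoPoint 0 a b).withDensity (fun _ => ENNReal.ofReal (1 - δ)) := by
    rw [withDensity_const, hν, twoPoint]
  rw [hμ, phiDiv_add_withDensity φ measurable_const hs, lintegral_const, measure_univ, mul_one,
    ENNReal.toReal_ofReal (by linarith), Measure.smul_apply, measure_univ, smul_eq_mul, mul_one,
    add_comm, ENNReal.ofReal_add (mul_nonneg hδ hM0) hv0, ENNReal.ofReal_mul hδ]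
  gcongr
  · exact EReal.toENNReal_le_ofReal hM
  · exact EReal.toENNReal_le_ofReal hv

theorem phiDiv_self (hφ : IsDivergenceGenerator φ) (ν : Measure Ω) [IsFiniteMeasure ν] :
    phiDiv φ ν ν = 0 := by
  have := phiDiv_add_withDensity φ (ν := ν) (f := 1) measurable_one
    Measure.MutuallySingular.zero_left
  rw [withDensity_one, zero_add] at this
  simp [this, hφ.map_one]

theorem vajda_le_of_conjOn_le (hA : MeasurableSet A) (ha : a ∈ A) (hb : b ∉ A)
    (hφ : IsDivergenceGenerator φ) {δ m : ℝ} (hδ : 0 ≤ δ)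
    (h : conjOn (Ici 0) (heightForWidth (psiConj φ)) δ ≤ m) :
    vajda (Ω := Ω) (phiDiv φ) (2 * δ) ≤ ENNReal.ofReal m := by
  rcases hδ.eq_or_lt with rfl | hδ
  · refine sInf_le_of_le ⟨Measure.dirac a, Measure.dirac a, inferInstance, inferInstance, ?_,
      rfl⟩ ?_
    · simp [tvDist]
    · rw [hφ.phiDiv_self]; exact zero_le
  -- Finiteness of `φ` at the second density value makes that value non-negative. This is exactly `p
  -- + δ ≤ 1`, needed for `μ` to be a probability measure.
  have hdom : ∀ x v : ℝ, φ x ≤ v → 0 ≤ x := by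
    intro x v hv
    by_contra! hx
    rw [hφ.eq_top_of_neg x hx] at hv
    simp at hv
  rcases hφ.exists_twoPoint_le_of_conjOn_le hδ h with ⟨p, u, v, hp, hp1, hu, hv, hm⟩ |
    ⟨M, v, hM, hv, hm⟩
  · have hq : 0 < 1 - p := by linarith
    have h1 := hdom _ _ hv
    rw [sub_nonneg, div_le_one hq] at h1
    refine sInf_le_of_le ⟨twoPoint (p + δ) a b, twoPoint p a b,
      isProbabilityMeasure_twoPoint (by linarith) (by linarith) a b,
      isProbabilityMeasure_twoPoint hp.le hp1.le a b,
      tvDist_twoPoint hA ha hb hp.le hδ.le (by linarith), rfl⟩ ?_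
    exact (hφ.phiDiv_twoPoint_le hA ha hb hp hp1 hδ.le (by linarith) hu hv).trans
      (ENNReal.ofReal_le_ofReal hm)
  · have h1 := hdom _ _ hv
    have htv := tvDist_twoPoint hA ha hb (p := 0) le_rfl hδ.le (by linarith)
    rw [zero_add] at htv
    have hM0 : 0 ≤ M := by
      have h2 : (0 : EReal) ≤ recession φ := by
        simpa using hφ.le_recession (y := 0) (c := 0) (by simpa using hφ.psiConj_le_neg le_rfl)
      exact_mod_cast h2.trans hM
    refine sInf_le_of_le ⟨twoPoint δ a b, twoPoint 0 a b,
      isProbabilityMeasure_twoPoint hδ.le (by linarith) a b,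
      isProbabilityMeasure_twoPoint le_rfl zero_le_one a b, htv, rfl⟩ ?_
    exact (phiDiv_twoPoint_zero_le hA ha hb hδ.le (by linarith) hφ hM hM0 hv).trans
      (ENNReal.ofReal_le_ofReal hm)

/-- The variational lower bound for the divergence. -/
theorem ofReal_mul_integral_sub_le_phiDiv (hφ : IsDivergenceGenerator φ) {t l c : ℝ}
    (h1 : psiConj φ (l + t) ≤ c) (h2 : psiConj φ (l - t) ≤ c) (ht : 0 ≤ t)
    {μ ν : Measure Ω} [IsProbabilityMeasure μ] [IsProbabilityMeasure ν] {g : Ω → ℝ}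
    (hg : g ∈ unitFunctions Ω) :
    ENNReal.ofReal (t * (∫ x, g x ∂μ - ∫ x, g x ∂ν) - c) ≤ phiDiv φ μ ν := by
  have hb : ∀ x, t * g x + l ∈ Icc (l - t) (l + t) := fun x => by
    have := mul_le_mul_of_nonneg_left (hg.2 x).1 ht
    have := mul_le_mul_of_nonneg_left (hg.2 x).2 ht
    constructor <;> linarith
  have hbm : Measurable fun x => t * g x + l := (hg.1.const_mul t).add_const l
  have hgi : ∀ ρ : Measure Ω, IsFiniteMeasure ρ → Integrable g ρ := fun ρ _ =>
    Integrable.of_bound hg.1.aestronglyMeasurable 1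
      (ae_of_all _ fun x => by rw [Real.norm_eq_abs, abs_le]; exact hg.2 x)
  have hbi : ∀ ρ : Measure Ω, IsFiniteMeasure ρ → Integrable (fun x => t * g x + l) ρ :=
    fun ρ _ => ((hgi ρ inferInstance).const_mul t).add (integrable_const l)
  have hbρ : ∀ ρ : Measure Ω, IsProbabilityMeasure ρ →
      ∫ x, (t * g x + l) ∂ρ = t * ∫ x, g x ∂ρ + l := fun ρ _ => by
    rw [integral_add ((hgi ρ inferInstance).const_mul t) (integrable_const l), integral_const_mul]
    simp
  set r : Ω → ℝ := fun x => (μ.rnDeriv ν x).toReal with hr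
  have hri : Integrable r ν := Measure.integrable_toReal_rnDeriv
  have hrbi : Integrable (fun x => r x * (t * g x + l)) ν := by
    refine hri.mul_bdd (c := |l| + |t|) hbm.aestronglyMeasurable (ae_of_all _ fun x => ?_)
    have := hb x
    rw [Real.norm_eq_abs, abs_le]
    constructor <;> linarith [this.1, this.2, neg_abs_le l, le_abs_self l, le_abs_self t]
  -- Young's inequality at each point, with `ψ*(t g + l) ≤ c`.
  have hpt : ∀ x, ENNReal.ofReal (r x * (t * g x + l) - (t * g x + l) - c) ≤
      (φ (r x)).toENNReal := by
    intro x
    have h3 := hφ.psiConj_sublevel_ordConnected h2 h1 (hb x)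
    rw [hφ.psiConj_le_coe_iff] at h3
    refine EReal.ofReal_le_toENNReal (EReal.le_of_forall_coe fun v hv => ?_)
    have := h3 (r x) v hv
    exact_mod_cast (by linarith : r x * (t * g x + l) - (t * g x + l) - c ≤ v)
  have hac : ENNReal.ofReal (∫ x, (r x * (t * g x + l) - (t * g x + l) - c) ∂ν) ≤
      ∫⁻ x, (φ (r x)).toENNReal ∂ν :=
    (ofReal_integral_le_lintegral_ofReal
      ((hrbi.sub (hbi ν inferInstance)).sub (integrable_const c))).trans (lintegral_mono hpt)
  have hsing : ENNReal.ofReal (∫ x, (t * g x + l) ∂(μ.singularPart ν)) ≤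
      μ.singularPart ν univ * (recession φ).toENNReal := by
    have h3 : ∫ x, (t * g x + l) ∂(μ.singularPart ν) ≤ ∫ _, (l + t) ∂(μ.singularPart ν) :=
      integral_mono (hbi _ inferInstance) (integrable_const _) fun x => (hb x).2
    refine (ENNReal.ofReal_le_ofReal h3).trans ?_
    rw [integral_const, smul_eq_mul, ENNReal.ofReal_mul measureReal_nonneg,
      ofReal_measureReal]
    gcongr
    exact EReal.ofReal_le_toENNReal (hφ.le_recession h1)
  have hsum : ∫ x, (t * g x + l) ∂μ =
      ∫ x, (t * g x + l) ∂(μ.singularPart ν) + ∫ x, r x * (t * g x + l) ∂ν := by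
    conv_lhs => rw [Measure.haveLebesgueDecomposition_add μ ν]
    rw [integral_add_measure (hbi _ inferInstance) (hbi _ inferInstance),
      integral_withDensity_eq_integral_toReal_smul (Measure.measurable_rnDeriv μ ν)
        (Measure.rnDeriv_lt_top μ ν)]
    simp only [smul_eq_mul, hr]
  have htot : t * (∫ x, g x ∂μ - ∫ x, g x ∂ν) - c =
      ∫ x, (r x * (t * g x + l) - (t * g x + l) - c) ∂ν +
        ∫ x, (t * g x + l) ∂(μ.singularPart ν) := by
    have h3 : ∫ x, (r x * (t * g x + l) - (t * g x + l) - c) ∂ν =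
        ∫ x, r x * (t * g x + l) ∂ν - ∫ x, (t * g x + l) ∂ν - ∫ _, c ∂ν := by
      rw [← integral_sub hrbi (hbi ν inferInstance)]
      exact integral_sub (hrbi.sub (hbi ν inferInstance)) (integrable_const c)
    rw [h3, integral_const]
    rw [hbρ μ inferInstance] at hsum
    rw [hbρ ν inferInstance]
    simp only [probReal_univ, one_smul]
    linarith
  rw [htot]
  exact ENNReal.ofReal_add_le.trans (add_le_add hac hsing)

theorem neg_mem_unitFunctions {g : Ω → ℝ} (hg : g ∈ unitFunctions Ω) :
    (fun x => -g x) ∈ unitFunctions Ω :=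
  ⟨hg.1.neg, fun x => ⟨by linarith [(hg.2 x).2], by linarith [(hg.2 x).1]⟩⟩

/-- The variational bound with `t = w / 2`, a near-optimal `l`, and the supremum over `g` and `-g`
give `w ε / 2 ≤ D + h(w)`, up to an arbitrarily small error. -/
theorem conjOn_le_phiDiv (hφ : IsDivergenceGenerator φ) {ε : ℝ}
    {μ ν : Measure Ω} [IsProbabilityMeasure μ] [IsProbabilityMeasure ν]
    (h : tvDist μ ν = ENNReal.ofReal ε) :
    conjOn (Ici 0) (heightForWidth (psiConj φ)) (ε / 2) ≤ (phiDiv φ μ ν : EReal) := by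
  rcases eq_or_ne (phiDiv φ μ ν) ⊤ with hD | hD
  · rw [hD]; exact le_top
  obtain ⟨D, hD0, hDe⟩ : ∃ D : ℝ, 0 ≤ D ∧ phiDiv φ μ ν = ENNReal.ofReal D :=
    ⟨_, ENNReal.toReal_nonneg, (ENNReal.ofReal_toReal hD).symm⟩
  rw [hDe, EReal.coe_ennreal_ofReal, max_eq_left hD0, hφ.conjOn_heightForWidth_le_coe_iff]
  intro w hw
  refine le_of_forall_pos_le_add fun η hη => ?_
  obtain ⟨l, h1, h2⟩ := hφ.exists_of_heightForWidth_lt (w := w)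
    (c := (heightForWidth (psiConj φ) w).toReal + η) hw (by
      rw [← hφ.coe_toReal_heightForWidth hw]
      exact_mod_cast (lt_add_of_pos_right _ hη))
  set c := (heightForWidth (psiConj φ) w).toReal + η
  have hc0 : 0 ≤ c := by exact_mod_cast (hφ.psiConj_nonneg _).trans h1
  have key : ∀ g ∈ unitFunctions Ω, w / 2 * (∫ x, g x ∂μ - ∫ x, g x ∂ν) ≤ D + c := by
    intro g hg
    have := hφ.ofReal_mul_integral_sub_le_phiDiv h1 h2 (by positivity) (μ := μ) (ν := ν) hg
    rw [hDe, ENNReal.ofReal_le_ofReal_iff hD0] at this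
    linarith
  rcases hw.eq_or_lt with rfl | hw
  · linarith
  have htv : tvDist μ ν ≤ ENNReal.ofReal ((D + c) / (w / 2)) := by
    refine iSup₂_le fun g hg => ENNReal.ofReal_le_ofReal ?_
    rw [le_div_iff₀ (by positivity)]
    have h3 := key g hg
    have h4 := key _ (neg_mem_unitFunctions hg)
    rw [integral_neg, integral_neg] at h4
    rcases abs_cases (∫ x, g x ∂μ - ∫ x, g x ∂ν) with ⟨h, _⟩ | ⟨h, _⟩ <;> rw [h] <;> linarith
  rw [h, ENNReal.ofReal_le_ofReal_iff (by positivity), le_div_iff₀ (by positivity)] at htv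
  linarith

theorem vajda_eq (hΩ : ∃ A : Set Ω, MeasurableSet A ∧ A ≠ ∅ ∧ A ≠ univ)
    (hφ : IsDivergenceGenerator φ) {ε : ℝ} (hε : 0 ≤ ε) :
    (vajda (Ω := Ω) (phiDiv φ) ε : EReal) =
      conjOn (Ici 0) (heightForWidth (psiConj φ)) (ε / 2) := by
  obtain ⟨A, hA, hne, hnu⟩ := hΩ
  obtain ⟨a, ha⟩ := nonempty_iff_ne_empty.2 hne
  obtain ⟨b, hb⟩ := (ne_univ_iff_exists_notMem A).1 hnu
  apply le_antisymm
  · refine EReal.le_of_forall_coe fun m hm => ?_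
    have h1 := vajda_le_of_conjOn_le hA ha hb hφ (by linarith) hm
    have hm0 : 0 ≤ m := by exact_mod_cast (hφ.conjOn_heightForWidth_nonneg _).trans hm
    rw [mul_div_cancel₀ _ (two_ne_zero)] at h1
    have h2 := EReal.coe_ennreal_le_coe_ennreal_iff.2 h1
    rwa [EReal.coe_ennreal_ofReal, max_eq_left hm0] at h2
  · have h0 := hφ.conjOn_heightForWidth_nonneg (ε / 2)
    rw [← EReal.coe_toENNReal h0, EReal.coe_ennreal_le_coe_ennreal_iff]
    refine le_sInf ?_
    rintro _ ⟨μ, ν, hμ, hν, htv, rfl⟩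
    rw [← EReal.coe_ennreal_le_coe_ennreal_iff, EReal.coe_toENNReal h0]
    exact hφ.conjOn_le_phiDiv htv

/-! ### Bounds on the cumulant generating function -/

theorem phiCgf_le (hφ : IsDivergenceGenerator φ) {t l c : ℝ}
    (h1 : psiConj φ (l + t) ≤ c) (h2 : psiConj φ (l - t) ≤ c) (ht : 0 ≤ t)
    {ν : Measure Ω} [IsProbabilityMeasure ν] {g : Ω → ℝ} (hg : ∀ x, g x ∈ Icc (-1 : ℝ) 1) :
    phiCgf φ g ν t ≤ ENNReal.ofReal c := by
  have hb : ∀ x, t * g x ∈ Icc (-t) t := fun x => by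
    have := mul_le_mul_of_nonneg_left (hg x).1 ht
    have := mul_le_mul_of_nonneg_left (hg x).2 ht
    constructor <;> linarith
  refine iInf₂_le_of_le l ?_ ?_
  · have hess : essSup (fun x => ((t * g x : ℝ) : EReal)) ν ≤ (t : EReal) :=
      essSup_le_of_ae_le _ (ae_of_all _ fun x => EReal.coe_le_coe_iff.2 (hb x).2)
    refine (add_le_add le_rfl hess).trans ?_
    exact_mod_cast hφ.le_recession h1
  · calc ∫⁻ x, (psiConj φ (t * g x + l)).toENNReal ∂ν ≤ ∫⁻ _, ENNReal.ofReal c ∂ν := by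
          refine lintegral_mono fun x => EReal.toENNReal_le_ofReal ?_
          refine hφ.psiConj_sublevel_ordConnected h2 h1 ⟨?_, ?_⟩ <;>
            linarith [(hb x).1, (hb x).2]
      _ = ENNReal.ofReal c := by simp

/-- Both masses must be positive: with `0 * ∞ = 0`, a null atom would hide an infinite value of
`ψ*`. -/
theorem le_phiCgf_twoPoint (hA : MeasurableSet A) (ha : a ∈ A) (hb : b ∉ A)
    (hφ : IsDivergenceGenerator φ) {t p m : ℝ} (hp : 0 < p) (hp1 : p < 1)
    (h : ∀ l c d : ℝ, psiConj φ (t + l) ≤ c → psiConj φ (-t + l) ≤ d → m ≤ p * c + (1 - p) * d) :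
    ENNReal.ofReal m ≤ phiCgf φ (signOf A) (twoPoint p a b) t := by
  have hq : 0 < 1 - p := by linarith
  refine le_iInf₂ fun l _ => ?_
  rw [lintegral_twoPoint_of_const hA ha hb p (c := (psiConj φ (t + l)).toENNReal)
      (d := (psiConj φ (-t + l)).toENNReal)
      (fun x hx => by rw [signOf_of_mem hx, mul_one])
      (fun x hx => by rw [signOf_of_notMem hx, mul_neg_one])]
  have h1 := hφ.psiConj_nonneg (t + l)
  have h2 := hφ.psiConj_nonneg (-t + l)
  have h3 := h l
  generalize psiConj φ (t + l) = x at *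
  generalize psiConj φ (-t + l) = y at *
  induction x with
  | bot => simp at h1
  | top => simp [ENNReal.mul_top, hp]
  | coe c =>
    induction y with
    | bot => simp at h2
    | top => simp [ENNReal.mul_top, hp1]
    | coe d =>
      have hc : 0 ≤ c := by exact_mod_cast h1
      have hd : 0 ≤ d := by exact_mod_cast h2
      rw [EReal.toENNReal_coe_real, EReal.toENNReal_coe_real, ← ENNReal.ofReal_mul hp.le,
        ← ENNReal.ofReal_mul hq.le,
        ← ENNReal.ofReal_add (mul_nonneg hp.le hc) (mul_nonneg hq.le hd)]
      exact ENNReal.ofReal_le_ofReal (h3 c d le_rfl le_rfl)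

theorem supPhiCgf_eq (hΩ : ∃ A : Set Ω, MeasurableSet A ∧ A ≠ ∅ ∧ A ≠ univ)
    (hφ : IsDivergenceGenerator φ) {t : ℝ} (ht : 0 ≤ t) :
    (supPhiCgf Ω φ t : EReal) = heightForWidth (psiConj φ) (2 * t) := by
  obtain ⟨A, hA, hne, hnu⟩ := hΩ
  obtain ⟨a, ha⟩ := nonempty_iff_ne_empty.2 hne
  obtain ⟨b, hb⟩ := (ne_univ_iff_exists_notMem A).1 hnu
  have h2t : 0 ≤ 2 * t := by linarith
  apply le_antisymm
  · by_contra! hlt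
    obtain ⟨c, hc1, hc2⟩ := EReal.lt_iff_exists_real_btwn.1 hlt
    obtain ⟨l, h1, h2⟩ := hφ.exists_of_heightForWidth_lt h2t hc1
    rw [mul_div_cancel_left₀ _ (two_ne_zero)] at h1 h2
    have hc0 : 0 ≤ c := by exact_mod_cast (hφ.psiConj_nonneg _).trans h1
    have h3 : supPhiCgf Ω φ t ≤ ENNReal.ofReal c :=
      iSup_le fun ν => iSup₂_le fun g hg => hφ.phiCgf_le h1 h2 ht hg.2
    have h4 := EReal.coe_ennreal_le_coe_ennreal_iff.2 h3
    rw [EReal.coe_ennreal_ofReal, max_eq_left hc0] at h4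
    exact absurd h4 (not_le.2 hc2)
  · rw [← hφ.coe_toReal_heightForWidth h2t]
    have hH0 : 0 ≤ (heightForWidth (psiConj φ) (2 * t)).toReal :=
      EReal.toReal_nonneg (heightForWidth_nonneg _ _)
    obtain ⟨p, hp0, hp1, hp⟩ := hφ.exists_weight_heightForWidth_le ht
    set H := (heightForWidth (psiConj φ) (2 * t)).toReal
    -- The saddle weight may be `0` or `1`. Mixing it with `1/2` moves it inside `(0, 1)`, and since
    -- `ψ* ≥ 0` this costs only a factor `1 - η`.
    have key : ∀ η : ℝ, 0 < η → η < 1 → ENNReal.ofReal ((1 - η) * H) ≤ supPhiCgf Ω φ t := by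
      intro η hη hη1
      have hpη : 0 ≤ (1 - η) * p := mul_nonneg (by linarith) hp0
      have hqη : 0 ≤ (1 - η) * (1 - p) := mul_nonneg (by linarith) (by linarith)
      have h1 := le_phiCgf_twoPoint hA ha hb hφ (t := t) (p := (1 - η) * p + η / 2)
        (m := (1 - η) * H) (by linarith) (by linarith) fun l c d hc hd => by
          have hc0 : 0 ≤ c := by exact_mod_cast (hφ.psiConj_nonneg _).trans hc
          have hd0 : 0 ≤ d := by exact_mod_cast (hφ.psiConj_nonneg _).trans hd
          have h2 := mul_le_mul_of_nonneg_left (hp l c d hc hd) (by linarith : 0 ≤ 1 - η)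
          have h3 := mul_nonneg hη.le hc0
          have h4 := mul_nonneg hη.le hd0
          linarith
      exact h1.trans (le_iSup_of_le ⟨twoPoint ((1 - η) * p + η / 2) a b,
        isProbabilityMeasure_twoPoint (by linarith) (by linarith) a b⟩
        (le_iSup₂_of_le (signOf A) (signOf_mem_unitFunctions hA) le_rfl))
    rcases eq_or_ne (supPhiCgf Ω φ t) ⊤ with hS | hS
    · rw [hS]; exact le_top
    rw [← ENNReal.ofReal_toReal hS] at key ⊢
    have hs0 : 0 ≤ (supPhiCgf Ω φ t).toReal := ENNReal.toReal_nonneg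
    generalize (supPhiCgf Ω φ t).toReal = s at *
    rw [EReal.coe_ennreal_ofReal, max_eq_left hs0, EReal.coe_le_coe_iff]
    by_contra! hlt
    have hH : 0 < H := by linarith
    -- This `η` makes `(1 - η) H` the midpoint of `s` and `H`.
    have h1 := key ((H - s) / (2 * H)) (by apply div_pos <;> linarith)
      (by rw [div_lt_one (by linarith)]; linarith)
    rw [ENNReal.ofReal_le_ofReal_iff hs0] at h1
    have h2 : (1 - (H - s) / (2 * H)) * H = H - (H - s) / 2 := by field_simp
    linarith

end IsDivergenceGenerator

end TwoPoint

/-! ### The Kullback--Leibler divergence -/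

section KullbackLeibler

open InformationTheory

theorem klGenerator_le_coe_iff {x v : ℝ} : klGenerator x ≤ v ↔ 0 ≤ x ∧ klFun x ≤ v := by
  rw [klGenerator]
  split_ifs with h
  · simp [h]
  · simp [h]

theorem isDivergenceGenerator_klGenerator : IsDivergenceGenerator klGenerator where
  convex := by
    simp only [klGenerator_le_coe_iff]
    exact convexOn_klFun.convex_epigraph
  lsc := by
    rw [lowerSemicontinuous_iff_isClosed_preimage]
    intro c
    induction c with
    | bot =>
      convert isClosed_empty
      ext x
      simp only [mem_preimage, mem_Iic, le_bot_iff, mem_empty_iff_false, iff_false, klGenerator]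
      split_ifs <;> simp
    | top => simp
    | coe c =>
      have : klGenerator ⁻¹' Iic (c : EReal) = Ici 0 ∩ {x | klFun x ≤ c} := by
        ext x; exact klGenerator_le_coe_iff
      rw [this]
      exact isClosed_Ici.inter (isClosed_le continuous_klFun continuous_const)
  map_one := by simp [klGenerator, klFun_one]
  nonneg x := by
    rw [klGenerator]
    split_ifs with h
    · exact_mod_cast klFun_nonneg h
    · exact le_top
  eq_top_of_neg x hx := by rw [klGenerator, if_neg (not_le.2 hx)]
  dom_mem_nhds := by
    filter_upwards [Ici_mem_nhds (zero_lt_one (α := ℝ))] with x hx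
    show klGenerator x < ⊤
    rw [klGenerator, if_pos (mem_Ici.1 hx)]
    exact EReal.coe_lt_top _

theorem psiConj_klGenerator (y : ℝ) :
    psiConj klGenerator y = ((Real.exp y - 1 - y : ℝ) : EReal) := by
  refine le_antisymm ?_ (EReal.le_of_forall_coe fun c hc => ?_)
  · rw [isDivergenceGenerator_klGenerator.psiConj_le_coe_iff]
    intro x v hv
    obtain ⟨hx, hv⟩ := klGenerator_le_coe_iff.1 hv
    rw [klFun_apply] at hv
    have key : x * (y - Real.log x + 1) ≤ Real.exp y := by
      rcases hx.eq_or_lt with rfl | hx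
      · simpa using (Real.exp_pos y).le
      · calc x * (y - Real.log x + 1) ≤ x * Real.exp (y - Real.log x) :=
              mul_le_mul_of_nonneg_left (Real.add_one_le_exp _) hx.le
          _ = Real.exp y := by rw [Real.exp_sub, Real.exp_log hx]; field_simp
    linarith
  -- The supremum is attained at `x = exp y`.
  · have := isDivergenceGenerator_klGenerator.psiConj_le_coe_iff.1 hc (Real.exp y)
      (klFun (Real.exp y)) (klGenerator_le_coe_iff.2 ⟨(Real.exp_pos y).le, le_rfl⟩)
    rw [klFun_apply, Real.log_exp] at this
    exact_mod_cast (by linarith : Real.exp y - 1 - y ≤ c)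

/-- `ψ*` is finite everywhere, so `le_recession` applies at every real number. -/
theorem recession_klGenerator : recession klGenerator = ⊤ := by
  refine EReal.eq_top_iff_forall_lt _ |>.2 fun y => ?_
  refine lt_of_lt_of_le (EReal.coe_lt_coe_iff.2 (lt_add_one y))
    (isDivergenceGenerator_klGenerator.le_recession (psiConj_klGenerator (y + 1)).le)

theorem phiDiv_klGenerator {Ω : Type*} [MeasurableSpace Ω] (μ ν : Measure Ω)
    [IsFiniteMeasure μ] [IsFiniteMeasure ν] : phiDiv klGenerator μ ν = klDiv μ ν := by
  rw [phiDiv, klDiv_eq_lintegral_klFun, recession_klGenerator, EReal.toENNReal_top]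
  have h1 : ∫⁻ x, (klGenerator (μ.rnDeriv ν x).toReal).toENNReal ∂ν =
      ∫⁻ x, ENNReal.ofReal (klFun (μ.rnDeriv ν x).toReal) ∂ν := by
    refine lintegral_congr fun x => ?_
    rw [klGenerator, if_pos ENNReal.toReal_nonneg, EReal.toENNReal_coe_real]
  split_ifs with h
  · rw [h1, (Measure.singularPart_eq_zero μ ν).2 h]
    simp
  · have h2 : μ.singularPart ν univ ≠ 0 := fun h0 =>
      h ((Measure.singularPart_eq_zero μ ν).1 (Measure.measure_univ_eq_zero.1 h0))
    rw [ENNReal.mul_top h2, add_top]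

/-- The hypothesis says that `y` lies beyond `x` as seen from `0`, the minimum of this convex
function; the tangent at `x` gives the bound. -/
theorem exp_sub_one_sub_le {x y : ℝ} (h : 0 ≤ x * (y - x)) :
    Real.exp x - 1 - x ≤ Real.exp y - 1 - y := by
  have h1 : Real.exp x * (1 + (y - x)) ≤ Real.exp y := by
    calc Real.exp x * (1 + (y - x)) ≤ Real.exp x * Real.exp (y - x) :=
          mul_le_mul_of_nonneg_left (by linarith [Real.add_one_le_exp (y - x)]) (Real.exp_pos x).le
      _ = Real.exp y := by rw [← Real.exp_add]; ring_nf
  have h2 : 0 ≤ (Real.exp x - 1) * (y - x) := by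
    rcases lt_trichotomy x 0 with hx | rfl | hx
    · have h3 : y - x ≤ 0 := by by_contra! h3; nlinarith
      have h4 : Real.exp x ≤ 1 := Real.exp_le_one_iff.2 hx.le
      nlinarith
    · simp
    · have h3 : 0 ≤ y - x := nonneg_of_mul_nonneg_right h hx
      have h4 : 1 ≤ Real.exp x := Real.one_le_exp hx.le
      nlinarith
  linarith

theorem heightForWidth_klGenerator {w : ℝ} (hw : 0 < w) :
    heightForWidth (psiConj klGenerator) w =
      ((-1 + w / 2 * (Real.cosh (w / 2) / Real.sinh (w / 2))
        + Real.log (2 * Real.sinh (w / 2) / w) : ℝ) : EReal) := by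
  rw [isDivergenceGenerator_klGenerator.heightForWidth_eq_iInf hw.le]
  obtain ⟨s, rfl⟩ : ∃ s, w = 2 * s := ⟨w / 2, by ring⟩
  have hs : 0 < s := by linarith
  rw [mul_div_cancel_left₀ _ (two_ne_zero' ℝ)]
  have hsh : 0 < Real.sinh s := Real.sinh_pos_iff.2 hs
  -- The centre `k` solves `exp (k + s) - exp (k - s) = 2 s`, so `ψ*` agrees at both endpoints. As
  -- `k - s ≤ 0 ≤ k + s`, moving the centre either way raises one of the two values.
  obtain ⟨k, hk⟩ : ∃ k, k = Real.log (s / Real.sinh s) := ⟨_, rfl⟩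
  have hek : Real.exp k = s / Real.sinh s := by rw [hk, Real.exp_log (by positivity)]
  have hlog : Real.log (2 * Real.sinh s / (2 * s)) = -k := by
    rw [mul_div_mul_left _ _ (two_ne_zero' ℝ), hk, ← Real.log_inv, inv_div]
  have hv1 : Real.exp (k + s) - 1 - (k + s) =
      -1 + s * (Real.cosh s / Real.sinh s) + Real.log (2 * Real.sinh s / (2 * s)) := by
    rw [hlog, Real.exp_add, hek, ← Real.cosh_add_sinh s]
    field_simp; ring
  have hv2 : Real.exp (k - s) - 1 - (k - s) =
      -1 + s * (Real.cosh s / Real.sinh s) + Real.log (2 * Real.sinh s / (2 * s)) := by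
    rw [hlog, sub_eq_add_neg k s, Real.exp_add, hek, ← Real.cosh_sub_sinh s]
    field_simp; ring
  have hk1 : 0 ≤ k + s := by
    rw [← Real.one_le_exp_iff, Real.exp_add, hek, div_mul_eq_mul_div, one_le_div hsh,
      Real.sinh_eq]
    have h1 := Real.add_one_le_exp (-(2 * s))
    have h2 : Real.exp (-s) = Real.exp s * Real.exp (-(2 * s)) := by
      rw [← Real.exp_add]; ring_nf
    rw [h2]
    nlinarith [mul_le_mul_of_nonneg_left h1 (Real.exp_pos s).le]
  have hk2 : k - s ≤ 0 := by
    rw [← Real.exp_le_one_iff, sub_eq_add_neg, Real.exp_add, hek, div_mul_eq_mul_div,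
      div_le_one hsh, Real.sinh_eq]
    have h1 := Real.add_one_le_exp (2 * s)
    have h2 : Real.exp s = Real.exp (-s) * Real.exp (2 * s) := by
      rw [← Real.exp_add]; ring_nf
    rw [h2]
    nlinarith [mul_le_mul_of_nonneg_left h1 (Real.exp_pos (-s)).le]
  simp only [psiConj_klGenerator]
  refine le_antisymm (iInf_le_of_le k (max_le ?_ ?_)) (le_iInf fun l => ?_)
  · rw [hv1]
  · rw [hv2]
  · rcases le_total k l with h | h
    · refine le_max_of_le_left (EReal.coe_le_coe_iff.2 ?_)
      rw [← hv1]
      exact exp_sub_one_sub_le (mul_nonneg hk1 (by linarith))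
    · refine le_max_of_le_right (EReal.coe_le_coe_iff.2 ?_)
      rw [← hv2]
      exact exp_sub_one_sub_le (mul_nonneg_of_nonpos_of_nonpos hk2 (by linarith))

theorem hasDerivAt_heightForWidth_klGenerator {t : ℝ} (ht : 0 < t) :
    HasDerivAt (fun w => (heightForWidth (psiConj klGenerator) w).toReal)
      ((2 * (Real.cosh t / Real.sinh t) - t / Real.sinh t ^ 2 - 1 / t) / 2) (2 * t) := by
  have hsh : 0 < Real.sinh t := Real.sinh_pos_iff.2 ht
  have hhalf : HasDerivAt (fun w : ℝ => w / 2) (1 / 2) (2 * t) := (hasDerivAt_id _).div_const 2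
  have e : 2 * t / 2 = t := by ring
  have hs : HasDerivAt (fun w : ℝ => Real.sinh (w / 2)) (Real.cosh t * (1 / 2)) (2 * t) := by
    have := hhalf.sinh
    rwa [e] at this
  have hc : HasDerivAt (fun w : ℝ => Real.cosh (w / 2)) (Real.sinh t * (1 / 2)) (2 * t) := by
    have := hhalf.cosh
    rwa [e] at this
  have h1 := hhalf.mul (hc.div hs (by rw [e]; exact hsh.ne'))
  have h2 := ((hs.const_mul 2).div (hasDerivAt_id (2 * t)) (by simpa using ht.ne')).log
    (by simp only [Pi.div_apply, id, e]; positivity)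
  have h3 := (h1.const_add (-1)).add h2
  refine (h3.congr_of_eventuallyEq ?_).congr_deriv ?_
  · filter_upwards [eventually_gt_nhds (show 0 < 2 * t by linarith)] with w hw
    rw [heightForWidth_klGenerator hw, EReal.toReal_coe]
    rfl
  · simp only [Pi.div_apply, id, e]
    have := Real.cosh_sq t
    field_simp
    rw [this]
    ring

theorem vajda_klDiv {Ω : Type*} [MeasurableSpace Ω] (ε : ℝ) :
    vajda (Ω := Ω) klDiv ε = vajda (Ω := Ω) (phiDiv klGenerator) ε := by
  unfold vajda
  congr 1
  ext d
  constructor <;> rintro ⟨μ, ν, hμ, hν, htv, rfl⟩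
  · exact ⟨μ, ν, hμ, hν, htv, (phiDiv_klGenerator μ ν).symm⟩
  · exact ⟨μ, ν, hμ, hν, htv, phiDiv_klGenerator μ ν⟩

/-! ### The refined Hoeffding lemma -/

section Cgf

open ProbabilityTheory

variable {Ω : Type*} [MeasurableSpace Ω] {ν : Measure Ω} [IsProbabilityMeasure ν] {g : Ω → ℝ}
  {t : ℝ}

theorem integral_psiConj_klGenerator (hg : Integrable g ν)
    (he : Integrable (fun x => Real.exp (t * g x)) ν) (l : ℝ) :
    Integrable (fun x => Real.exp (t * g x + l) - 1 - (t * g x + l)) ν ∧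
      ∫ x, (Real.exp (t * g x + l) - 1 - (t * g x + l)) ∂ν =
        Real.exp l * mgf g ν t - 1 - (t * ∫ x, g x ∂ν + l) := by
  have h1 : Integrable (fun x => Real.exp (t * g x + l) - 1) ν := by
    simp only [Real.exp_add]
    exact (he.mul_const _).sub (integrable_const 1)
  have h2 : Integrable (fun x => t * g x + l) ν := (hg.const_mul t).add (integrable_const l)
  refine ⟨h1.sub h2, ?_⟩
  rw [integral_sub h1 h2, integral_add (hg.const_mul t) (integrable_const l), integral_const_mul]
  simp only [Real.exp_add]
  rw [integral_sub (he.mul_const _) (integrable_const 1), integral_mul_const, mgf]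
  simp [mul_comm]

theorem cgf_sub_integral (he : Integrable (fun x => Real.exp (t * g x)) ν) :
    cgf (fun x => g x - ∫ y, g y ∂ν) ν t = cgf g ν t - t * ∫ x, g x ∂ν := by
  have h := mgf_pos he
  rw [cgf, cgf, show (fun x => g x - ∫ y, g y ∂ν) = fun x => g x + -∫ y, g y ∂ν from rfl,
    mgf_add_const, Real.log_mul h.ne' (Real.exp_pos _).ne', Real.log_exp]
  ring

/-- With `Λ = cgf g ν t`, this is `exp (l + Λ) ≥ 1 + l + Λ`; equality at `l = -Λ` is the next lemma.
-/
theorem cgf_sub_integral_le (hg : Integrable g ν)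
    (he : Integrable (fun x => Real.exp (t * g x)) ν) (l : ℝ) :
    cgf (fun x => g x - ∫ y, g y ∂ν) ν t ≤
      ∫ x, (Real.exp (t * g x + l) - 1 - (t * g x + l)) ∂ν := by
  rw [cgf_sub_integral he, (integral_psiConj_klGenerator hg he l).2]
  have h1 := Real.add_one_le_exp (l + cgf g ν t)
  rw [Real.exp_add, exp_cgf he] at h1
  linarith

theorem cgf_sub_integral_eq (hg : Integrable g ν)
    (he : Integrable (fun x => Real.exp (t * g x)) ν) :
    cgf (fun x => g x - ∫ y, g y ∂ν) ν t =
      ∫ x, (Real.exp (t * g x + -cgf g ν t) - 1 - (t * g x + -cgf g ν t)) ∂ν := by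
  rw [cgf_sub_integral he, (integral_psiConj_klGenerator hg he _).2, ← exp_cgf he,
    ← Real.exp_add]
  simp
  ring

theorem phiCgf_klGenerator (hg : Integrable g ν)
    (he : Integrable (fun x => Real.exp (t * g x)) ν) :
    (phiCgf klGenerator g ν t : EReal) =
      ((cgf (fun x => g x - ∫ y, g y ∂ν) ν t : ℝ) : EReal) := by
  have hnn : ∀ x : ℝ, 0 ≤ Real.exp x - 1 - x := fun x => by linarith [Real.add_one_le_exp x]
  have hl : ∀ l : ℝ, ∫⁻ x, (psiConj klGenerator (t * g x + l)).toENNReal ∂ν =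
      ENNReal.ofReal (∫ x, (Real.exp (t * g x + l) - 1 - (t * g x + l)) ∂ν) := fun l => by
    rw [ofReal_integral_eq_lintegral_ofReal (integral_psiConj_klGenerator hg he l).1
      (ae_of_all _ fun x => hnn _)]
    simp only [psiConj_klGenerator, EReal.toENNReal_coe_real]
  have h0 : 0 ≤ cgf (fun x => g x - ∫ y, g y ∂ν) ν t := by
    rw [cgf_sub_integral_eq hg he]
    exact integral_nonneg fun x => hnn _
  have hK : phiCgf klGenerator g ν t =
      ENNReal.ofReal (cgf (fun x => g x - ∫ y, g y ∂ν) ν t) := by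
    refine le_antisymm (iInf₂_le_of_le (-cgf g ν t) ?_ ?_) (le_iInf₂ fun l _ => ?_)
    -- The constraint on `l` is vacuous, since `φ'(∞) = ∞`.
    · show _ ≤ recession klGenerator
      rw [recession_klGenerator]; exact le_top
    · rw [hl, ← cgf_sub_integral_eq hg he]
    · rw [hl]
      exact ENNReal.ofReal_le_ofReal (cgf_sub_integral_le hg he l)
  rw [hK, EReal.coe_ennreal_ofReal, max_eq_left h0]

theorem integrable_of_ae_mem_Icc {m M : ℝ} (hg : Measurable g)
    (h : ∀ᵐ x ∂ν, m ≤ g x ∧ g x ≤ M) (t : ℝ) :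
    Integrable g ν ∧ Integrable (fun x => Real.exp (t * g x)) ν :=
  ⟨Integrable.of_mem_Icc m M hg.aemeasurable h,
    integrable_exp_mul_of_mem_Icc hg.aemeasurable h⟩

theorem cgf_le_heightForWidth_klGenerator {m M : ℝ} (hg : Measurable g)
    (h : ∀ᵐ x ∂ν, m ≤ g x ∧ g x ≤ M) (h0 : ∫ x, g x ∂ν = 0) (ht : 0 ≤ t) :
    ((cgf g ν t : ℝ) : EReal) ≤ heightForWidth (psiConj klGenerator) ((M - m) * t) := by
  obtain ⟨hgi, he⟩ := integrable_of_ae_mem_Icc hg h t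
  have hmM : m ≤ M := by
    obtain ⟨x, hx⟩ := h.exists
    exact hx.1.trans hx.2
  have hw : 0 ≤ (M - m) * t := mul_nonneg (by linarith) ht
  by_contra! hlt
  obtain ⟨c, hc1, hc2⟩ := EReal.lt_iff_exists_real_btwn.1 hlt
  obtain ⟨l, h1, h2⟩ := isDivergenceGenerator_klGenerator.exists_of_heightForWidth_lt hw hc1
  -- Subtracting `t (m + M) / 2` recentres the range `[t m, t M]` at `l`, so that it fills the
  -- interval of width `(M - m) t` found in the sublevel set.
  have h3 := cgf_sub_integral_le hgi he (l - t * ((m + M) / 2))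
  simp only [h0, sub_zero] at h3
  have h4 : ∫ x, (Real.exp (t * g x + (l - t * ((m + M) / 2))) - 1 -
      (t * g x + (l - t * ((m + M) / 2)))) ∂ν ≤ ∫ _, c ∂ν := by
    refine integral_mono_ae (integral_psiConj_klGenerator hgi he _).1 (integrable_const c) ?_
    filter_upwards [h] with x hx
    have h5 := mul_le_mul_of_nonneg_left hx.1 ht
    have h6 := mul_le_mul_of_nonneg_left hx.2 ht
    have h7 := isDivergenceGenerator_klGenerator.psiConj_sublevel_ordConnected h2 h1
      (x := t * g x + (l - t * ((m + M) / 2))) ⟨by linarith, by linarith⟩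
    rw [psiConj_klGenerator] at h7
    exact_mod_cast h7
  rw [integral_const, probReal_univ, one_smul] at h4
  have h5 : c < cgf g ν t := by exact_mod_cast hc2
  linarith

end Cgf

end KullbackLeibler

/-! ### Parametric form and the main theorem -/

theorem IsDivergenceGenerator.vajda_eq_of_hasDerivWithinAt {Ω : Type*} [MeasurableSpace Ω]
    (hΩ : ∃ A : Set Ω, MeasurableSet A ∧ A ≠ ∅ ∧ A ≠ univ) {φ : ℝ → EReal}
    (hφ : IsDivergenceGenerator φ) {x d : ℝ} (hx : 0 ≤ x)
    (hd : HasDerivWithinAt (fun w => (heightForWidth (psiConj φ) w).toReal) d (Ici 0) x) :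
    (vajda (Ω := Ω) (phiDiv φ) (2 * d) : EReal) =
      ((x * d : ℝ) : EReal) - heightForWidth (psiConj φ) x := by
  have hd0 := hφ.nonneg_of_hasDerivWithinAt_heightForWidth hx hd
  rw [hφ.vajda_eq hΩ (by linarith), mul_div_cancel_left₀ _ (two_ne_zero' ℝ),
    hφ.conjOn_heightForWidth_eq_of_hasDerivWithinAt hx hd]

theorem mainTheorem9 {Ω : Type*} [MeasurableSpace Ω]
    (hΩ : ∃ A : Set Ω, MeasurableSet A ∧ A ≠ ∅ ∧ A ≠ Set.univ) :
    -- arbitrary generators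
    (∀ φ : ℝ → EReal, IsDivergenceGenerator φ →
      -- the height-for-width function is finite, and is the value of a minimization problem
      (∀ w : ℝ, 0 ≤ w →
        heightForWidth (psiConj φ) w ≠ ⊥ ∧ heightForWidth (psiConj φ) w ≠ ⊤ ∧
        heightForWidth (psiConj φ) w =
          ⨅ l : ℝ, max (psiConj φ (l + w / 2)) (psiConj φ (l - w / 2))) ∧
      -- the optimal bound on the cumulant generating functions
      (∀ t : ℝ, 0 ≤ t →
        (supPhiCgf Ω φ t : EReal) = heightForWidth (psiConj φ) (2 * t)) ∧
      -- Vajda's problem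
      (∀ ε : ℝ, 0 ≤ ε →
        (vajda (Ω := Ω) (phiDiv φ) ε : EReal) =
          conjOn (Set.Ici 0) (heightForWidth (psiConj φ)) (ε / 2)) ∧
      (∀ x d : ℝ, 0 ≤ x →
        HasDerivWithinAt (fun w => (heightForWidth (psiConj φ) w).toReal) d (Set.Ici 0) x →
        (vajda (Ω := Ω) (phiDiv φ) (2 * d) : EReal) =
          ((x * d : ℝ) : EReal) - heightForWidth (psiConj φ) x)) ∧
    -- the Kullback--Leibler divergence
    IsDivergenceGenerator klGenerator ∧
    (∀ μ ν : MeasureTheory.Measure Ω, MeasureTheory.IsProbabilityMeasure μ →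
      MeasureTheory.IsProbabilityMeasure ν →
      phiDiv klGenerator μ ν = InformationTheory.klDiv μ ν) ∧
    (∀ w : ℝ, 0 < w →
      heightForWidth (psiConj klGenerator) w =
        ((-1 + w / 2 * (Real.cosh (w / 2) / Real.sinh (w / 2))
          + Real.log (2 * Real.sinh (w / 2) / w) : ℝ) : EReal)) ∧
    -- the refined Hoeffding lemma
    (∀ (ν : MeasureTheory.Measure Ω) (g : Ω → ℝ) (t : ℝ),
      MeasureTheory.IsProbabilityMeasure ν → Measurable g → (∃ C : ℝ, ∀ x, |g x| ≤ C) →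
      (phiCgf klGenerator g ν t : EReal) =
        ((ProbabilityTheory.cgf (fun x => g x - ∫ y, g y ∂ν) ν t : ℝ) : EReal)) ∧
    (∀ (ν : MeasureTheory.Measure Ω) (g : Ω → ℝ) (m M t : ℝ),
      MeasureTheory.IsProbabilityMeasure ν → Measurable g → (∀ᵐ x ∂ν, m ≤ g x ∧ g x ≤ M) →
      ∫ x, g x ∂ν = 0 → 0 ≤ t →
      ((ProbabilityTheory.cgf g ν t : ℝ) : EReal) ≤
        heightForWidth (psiConj klGenerator) ((M - m) * t)) ∧
    -- the Fedotov--Harremoes--Topsoe formula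
    (∀ t : ℝ, 0 < t →
      (vajda (Ω := Ω) InformationTheory.klDiv
        (2 * (Real.cosh t / Real.sinh t) - t / Real.sinh t ^ 2 - 1 / t) : EReal) =
        ((Real.log (t / Real.sinh t) + t * (Real.cosh t / Real.sinh t)
          - t ^ 2 / Real.sinh t ^ 2 : ℝ) : EReal)) := by
  refine ⟨fun φ hφ => ⟨fun w hw => ⟨IsDivergenceGenerator.heightForWidth_ne_bot φ w,
      hφ.heightForWidth_ne_top hw, hφ.heightForWidth_eq_iInf hw⟩,
    fun t ht => hφ.supPhiCgf_eq hΩ ht, fun ε hε => hφ.vajda_eq hΩ hε, fun x d hx hd => ?_⟩,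
    isDivergenceGenerator_klGenerator, fun μ ν _ _ => phiDiv_klGenerator μ ν,
    fun w hw => heightForWidth_klGenerator hw, fun ν g t _ hg hC => ?_,
    fun ν g m M t _ hg h h0 ht => cgf_le_heightForWidth_klGenerator hg h h0 ht, fun t ht => ?_⟩
  · exact hφ.vajda_eq_of_hasDerivWithinAt hΩ hx hd
  · obtain ⟨C, hC⟩ := hC
    obtain ⟨hgi, he⟩ := integrable_of_ae_mem_Icc (ν := ν) hg
      (ae_of_all _ fun x => abs_le.1 (hC x)) t
    exact phiCgf_klGenerator hgi he
  -- The parametric form at `x = 2t`, where the distance is `2 h'(2t) = V(t)`.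
  · have h := isDivergenceGenerator_klGenerator.vajda_eq_of_hasDerivWithinAt hΩ
      (by linarith : 0 ≤ 2 * t) (hasDerivAt_heightForWidth_klGenerator ht).hasDerivWithinAt
    rw [mul_div_cancel₀ _ (two_ne_zero' ℝ), ← vajda_klDiv,
      heightForWidth_klGenerator (by linarith), ← EReal.coe_sub] at h
    rw [h, EReal.coe_eq_coe_iff, mul_div_cancel_left₀ _ (two_ne_zero' ℝ),
      mul_div_mul_left _ _ (two_ne_zero' ℝ), ← inv_div t (Real.sinh t), Real.log_inv]
    have hsh : Real.sinh t ≠ 0 := (Real.sinh_pos_iff.2 ht).ne'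
    field_simp
    ring
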